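/- **Proposition.** Let $C>1$ and $p\in(0,1/2)$. Let $Z\sim\mathcal N(0,1)$, let $c_p>0$ be the unique real number with $\mathbb P[Z\le -c_p]=p$, and put $$a=\frac{e^{-c_p^2/2}}{\sqrt{2\pi}},\qquad \gamma(p)=1-\operatorname{Var}(Z\mid Z\le -c_p),\qquad \beta_{\mathrm{quad}}(p)=\frac{\gamma(p)\,a^4}{8p^4}.$$ For positive integers $r,d$ let $x_1,\dots,x_r$ be independent random vectors in $\mathbb R^d$ with law $\mathcal N(0,\frac1d I_d)$. They form a *red clique* if $\langle x_i,x_j\rangle<-c_p/\sqrt d$ for all $i\ne j$, that is, if the graph on $\{1,\dots,r\}$ in which distinct $i,j$ are adjacent when $\langle x_i,x_j\rangle\ge -c_p/\sqrt d$ has no edge. Given a positive integer $\ell$, put $\alpha=100\,C\log(10/p)$ and $\delta=\alpha d^{-1/4}$. The vectors are *perfect* if for every $1\le i\le r$ $$\|x_i\|_2\in(1-\delta,1+\delta)\qquad\text{and}\qquad \bigl\|\pi_{\operatorname{span}\{x_1,\dots,x_{i-1}\}}(x_i)\bigr\|_2\le\frac{\alpha\sqrt\ell}{\sqrt d},$$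 where $\pi_W$ is the orthogonal projection onto $W$. Let $P_{\mathrm{red},r}$ be the probability that $x_1,\dots,x_r$ form a red clique, and $P^*_{\mathrm{red},r}$ the probability that they form a red clique and are perfect. Then $\gamma(p)>0$ and $\beta_{\mathrm{quad}}(p)>0$, and there are constants $K,M,D_0>0$, depending only on $p$ and $C$, such that for every real $D\ge D_0$, every integer $\ell\ge1$ for which $d=D^2\ell^2$ is an integer, and every integer $r$ with $1\le r\le C\ell$, $$P^*_{\mathrm{red},r}\le p^{\binom r2}\exp\left(-\frac{a^3}{p^3\sqrt d}\binom r3+K\frac{r^3}{D\sqrt d}-\beta_{\mathrm{quad}}(p)\frac{r^4}{d}+\frac{M}{D}\cdot\frac{r^4}{d}\right),$$ and the same bound, with the same constants, holds for $P_{\mathrm{red},r}$. In particular, if $p=p_C$ is the unique solution in $(0,1/2)$ of $C=\log p/\log(1-p)$, the constants depend only on $p$. -/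

import Mathlib

open MeasureTheory ProbabilityTheory

namespace GaussianRamsey

/-! ### The threshold and the constants attached to the standard normal law -/

/-- The number `c_p` with `ℙ[Z ≤ -c_p] = p` for a standard Gaussian `Z`; that is, `-c_p` is the
`p`-quantile of the standard normal law (see `threshold_spec`). -/
noncomputable def threshold (p : ℝ) : ℝ :=
  -sInf {t : ℝ | p ≤ cdf (gaussianReal 0 1) t}

/-- `a = φ(c_p)`, where `φ` is the standard normal density. -/
noncomputable def aConst (p : ℝ) : ℝ :=
  gaussianPDFReal 0 1 (threshold p)

/-- `γ(p) = 1 - Var(Z ∣ Z ≤ -c_p)`: the variance is that of the identity under the standard normal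
law conditioned on the half-line `(-∞, -c_p]`. -/
noncomputable def gammaConst (p : ℝ) : ℝ :=
  1 - variance id (cond (gaussianReal 0 1) (Set.Iic (-threshold p)))

/-- `β_quad(p) = γ(p) a⁴ / (8 p⁴)`. -/
noncomputable def betaQuad (p : ℝ) : ℝ :=
  gammaConst p * aConst p ^ 4 / (8 * p ^ 4)

/-! ### The Gaussian random geometric graph -/

/-- The joint law of `r` independent vectors with law `N(0, I_d / d)`. -/
noncomputable def sampleLaw (r d : ℕ) : Measure (Fin r → EuclideanSpace ℝ (Fin d)) :=
  Measure.pi fun _ => multivariateGaussian 0 ((d : ℝ)⁻¹ • (1 : Matrix (Fin d) (Fin d) ℝ))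

/-- The geometric graph on the vectors `x 0, …, x (r - 1)`: distinct `i, j` are adjacent (joined by
a blue edge) when `⟨x i, x j⟩ ≥ -c_p / √d`. -/
def geomGraph (p : ℝ) {r d : ℕ} (x : Fin r → EuclideanSpace ℝ (Fin d)) : SimpleGraph (Fin r) where
  Adj i j := i ≠ j ∧ -threshold p / √(d : ℝ) ≤ inner ℝ (x i) (x j)
  symm := ⟨fun i j h => ⟨h.1.symm, by rw [real_inner_comm]; exact h.2⟩⟩
  loopless := ⟨fun _ h => h.1 rfl⟩

/-- The vectors form a red clique: the geometric graph has no edge. -/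
def IsRedClique (p : ℝ) {r d : ℕ} (x : Fin r → EuclideanSpace ℝ (Fin d)) : Prop :=
  (geomGraph p x).IsIndepSet Set.univ

/-- `α = 100 C log(10 / p)`. -/
noncomputable def alphaConst (C p : ℝ) : ℝ :=
  100 * C * Real.log (10 / p)

/-- `δ = α d^{-1/4}`. -/
noncomputable def deltaConst (C p : ℝ) (d : ℕ) : ℝ :=
  alphaConst C p * (d : ℝ) ^ (-(1 / 4) : ℝ)

/-- Perfect sequences: every vector has norm in `(1 - δ, 1 + δ)`, and its orthogonal projection onto
the span of the previous vectors has norm at most `α √ℓ / √d`. -/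
def IsPerfect (C p : ℝ) (ℓ : ℕ) {r d : ℕ} (x : Fin r → EuclideanSpace ℝ (Fin d)) : Prop :=
  ∀ i : Fin r,
    ‖x i‖ ∈ Set.Ioo (1 - deltaConst C p d) (1 + deltaConst C p d) ∧
    ‖(Submodule.span ℝ (x '' {j | j < i})).starProjection (x i)‖
      ≤ alphaConst C p * √(ℓ : ℝ) / √(d : ℝ)

/-- `P_{red,r}`: the probability that the random graph `G(r,d,p)` is an independent set. -/
noncomputable def probRed (p : ℝ) (r d : ℕ) : ℝ :=
  (sampleLaw r d).real {x | IsRedClique p x}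

/-- `P*_{red,r}`: the probability that the random vectors form a red clique and are perfect. -/
noncomputable def probRedPerfect (C p : ℝ) (ℓ r d : ℕ) : ℝ :=
  (sampleLaw r d).real {x | IsRedClique p x ∧ IsPerfect C p ℓ x}

/-! ### `threshold p` is the number it is meant to be -/

theorem cdf_strictMono : StrictMono (cdf (gaussianReal 0 1)) := by
  intro s t hst
  rw [cdf_eq_real, cdf_eq_real, ← Set.Iic_union_Ioc_eq_Iic hst.le,
    measureReal_union (Set.Iic_disjoint_Ioc le_rfl) measurableSet_Ioc]
  have h : gaussianReal 0 1 (Set.Ioc s t) ≠ 0 := by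
    intro h0
    have := gaussianReal_absolutelyContinuous' 0 (one_ne_zero) h0
    simp at this
    linarith
  have : 0 < (gaussianReal 0 1).real (Set.Ioc s t) := by
    rw [measureReal_def]
    exact ENNReal.toReal_pos h (measure_ne_top _ _)
  linarith

theorem cdf_continuous : Continuous (cdf (gaussianReal 0 1)) := by
  rw [continuous_iff_continuousAt]
  intro x
  have := nullSingletonClass_gaussianReal (μ := 0) (v := 1) one_ne_zero
  have h0 : (cdf (gaussianReal 0 1)).measure {x} = 0 := by
    rw [measure_cdf]; exact measure_singleton x
  rw [StieltjesFunction.measure_singleton, ENNReal.ofReal_eq_zero] at h0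
  have hle := (cdf (gaussianReal 0 1)).mono.leftLim_le (le_refl x)
  rw [(cdf (gaussianReal 0 1)).mono.continuousAt_iff_leftLim_eq_rightLim,
    (cdf (gaussianReal 0 1)).rightLim_eq]
  linarith

theorem cdf_zero : cdf (gaussianReal 0 1) 0 = 1 / 2 := by
  have hsymm : (gaussianReal 0 1).real (Set.Ici (0 : ℝ)) = (gaussianReal 0 1).real (Set.Iic 0) := by
    have h := gaussianReal_map_neg (μ := 0) (v := 1)
    rw [neg_zero] at h
    conv_lhs => rw [← h]
    rw [map_measureReal_apply measurable_neg measurableSet_Ici]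
    congr 1
    ext y
    simp
  have := nullSingletonClass_gaussianReal (μ := 0) (v := 1) one_ne_zero
  have hIci : (gaussianReal 0 1).real (Set.Ici (0 : ℝ)) = (gaussianReal 0 1).real (Set.Ioi 0) :=
    measureReal_congr Ioi_ae_eq_Ici.symm
  have hc := probReal_add_probReal_compl (μ := gaussianReal 0 1) (measurableSet_Iic (a := (0 : ℝ)))
  rw [Set.compl_Iic, ← hIci, hsymm] at hc
  rw [cdf_eq_real]
  linarith

/-- For `0 < p < 1/2`, `c_p` is positive and is the unique real `c` with `ℙ[Z ≤ -c] = p`. -/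
theorem threshold_spec {p : ℝ} (hp : p ∈ Set.Ioo (0 : ℝ) (1 / 2)) :
    0 < threshold p ∧ ∀ c : ℝ, (gaussianReal 0 1).real (Set.Iic (-c)) = p ↔ c = threshold p := by
  obtain ⟨t, ht⟩ : p ∈ Set.range (cdf (gaussianReal 0 1)) := by
    apply mem_range_of_exists_le_of_exists_ge cdf_continuous
    · exact ((tendsto_cdf_atBot _).eventually (eventually_le_nhds hp.1)).exists
    · exact ⟨0, by rw [cdf_zero]; exact hp.2.le⟩
  have hset : {s : ℝ | p ≤ cdf (gaussianReal 0 1) s} = Set.Ici t := by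
    ext s
    rw [Set.mem_ofPred_eq, ← ht, cdf_strictMono.le_iff_le, Set.mem_Ici]
  have hthr : threshold p = -t := by rw [threshold, hset, csInf_Ici]
  refine ⟨?_, fun c => ?_⟩
  · have : t < 0 := by
      rw [← cdf_strictMono.lt_iff_lt, ht, cdf_zero]
      exact hp.2
    linarith
  · rw [← cdf_eq_real, hthr, ← ht, cdf_strictMono.injective.eq_iff]
    constructor <;> intro h <;> linarith

end GaussianRamsey

namespace GaussianRamsey

open Set Real
open scoped Matrix

/-! ### The tail of the standard normal law -/

/-! Since √d = Dℓ and r ≤ Cℓ, one has r⁴/d ≤ C · r³/(D√d). Hence the constant K can pay for the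
whole term β_quad · r⁴/d, and it suffices to bound the red-clique probability by p^(r choose 2) ·
exp(-m³/√d · (r choose 3)) up to a factor exp(O(r⁴/d + r³/d)), where m = a/p = -E[Z ∣ Z ≤ -c]. This
is `probRed_le`. The perfect event is contained in the red-clique event and needs no separate
argument.

The cubic term comes from peeling off one vector at a time. Rescale to standard Gaussian vectors and
let e be the direction of the first one, x. Every other vector is gᵢe + zᵢ, with gᵢ a standard
normal variable and zᵢ an independent standard Gaussian vector in the complement of e. Redness at x
forces gᵢ below about -c√d/‖x‖, and redness of the pair (i, j) becomes ⟨zᵢ, zⱼ⟩ < -√d(c + gᵢgⱼ/√d).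
The threshold of each later pair has thus moved by gᵢgⱼ/√d, which is about m²/√d on average. By
log-concavity of the normal distribution function, a shift y costs a factor exp(-my)
(`cdf_tail_le`). Each triple therefore contributes exp(-m³/√d).

To make this rigorous, `PeelBound` is proved by induction for all Euclidean spaces and all
nonnegative level shifts S, with an exponent affine in S. The inductive step integrates exp(-Σ
tⱼgⱼgᵢ) over a truncated column of normal variables (`lintegral_columnWeight_le`). The norms survive
as independent chi-squared variables, whose fluctuations cost only O(r³/d) in the exponent
(`lintegral_peelExponent_le`). -/

theorem gaussianPDFReal_zero_one (x : ℝ) :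
    gaussianPDFReal 0 1 x = (√(2 * π))⁻¹ * exp (-x ^ 2 / 2) := by
  simp [gaussianPDFReal]

theorem cdf_gaussian_eq_integral (t : ℝ) :
    cdf (gaussianReal 0 1) t = ∫ x in Iic t, gaussianPDFReal 0 1 x := by
  rw [cdf_eq_real, measureReal_def, gaussianReal_apply_eq_integral 0 one_ne_zero,
    ENNReal.toReal_ofReal (integral_nonneg fun x => gaussianPDFReal_nonneg _ _ _)]

theorem continuous_gaussianPDFReal : Continuous (gaussianPDFReal 0 1) := by
  rw [show gaussianPDFReal 0 1 = fun x => (√(2 * π))⁻¹ * exp (-x ^ 2 / 2) from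
    funext gaussianPDFReal_zero_one]
  fun_prop

theorem hasDerivAt_gaussianPDFReal (x : ℝ) :
    HasDerivAt (gaussianPDFReal 0 1) (-x * gaussianPDFReal 0 1 x) x := by
  rw [show gaussianPDFReal 0 1 = fun x => (√(2 * π))⁻¹ * exp (-x ^ 2 / 2) from
    funext gaussianPDFReal_zero_one]
  convert! (((hasDerivAt_id x).pow 2).neg.div_const 2).exp.const_mul (√(2 * π))⁻¹ using 1
  simp
  ring

theorem cdf_gaussian_pos (t : ℝ) : 0 < cdf (gaussianReal 0 1) t :=
  (cdf_nonneg _ (t - 1)).trans_lt (cdf_strictMono (by linarith))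

theorem hasDerivAt_cdf_gaussian (t : ℝ) :
    HasDerivAt (cdf (gaussianReal 0 1)) (gaussianPDFReal 0 1 t) t := by
  have hint : Integrable (gaussianPDFReal 0 1) := integrable_gaussianPDFReal 0 1
  have h := intervalIntegral.integral_hasDerivAt_right
    (hint.intervalIntegrable (a := 0) (b := t))
    (continuous_gaussianPDFReal.stronglyMeasurableAtFilter _ _)
    continuous_gaussianPDFReal.continuousAt
  refine (h.const_add (cdf (gaussianReal 0 1) 0)).congr_of_eventuallyEq (.of_forall fun s => ?_)
  simp only [cdf_gaussian_eq_integral]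
  rw [← intervalIntegral.integral_Iic_sub_Iic hint.integrableOn hint.integrableOn]
  ring

/-- The ratio φ/Φ is decreasing. After translating one integral, both range over x ≤ s, and the
integrands compare pointwise by log-concavity of φ: the points s and x + t - s have the same sum as
x and t and lie between them. -/
theorem gaussianPDFReal_mul_cdf_le {s t : ℝ} (hst : s ≤ t) :
    gaussianPDFReal 0 1 t * cdf (gaussianReal 0 1) s ≤
      gaussianPDFReal 0 1 s * cdf (gaussianReal 0 1) t := by
  have hint : Integrable (gaussianPDFReal 0 1) := integrable_gaussianPDFReal 0 1
  have hshift : cdf (gaussianReal 0 1) t = ∫ x in Iic s, gaussianPDFReal 0 1 (x + (t - s)) := by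
    rw [cdf_gaussian_eq_integral]
    have h := (measurePreserving_add_right volume (t - s)).setIntegral_preimage_emb
      (measurableEmbedding_addRight _) (gaussianPDFReal 0 1) (Iic t)
    rw [← h]
    congr 2
    ext x
    simp
  rw [hshift, cdf_gaussian_eq_integral, ← integral_const_mul, ← integral_const_mul]
  refine setIntegral_mono_on (hint.const_mul _).integrableOn
    ((hint.comp_add_right (t - s)).const_mul _).integrableOn measurableSet_Iic fun x hx => ?_
  simp only [gaussianPDFReal_zero_one]
  have : exp (-t ^ 2 / 2) * exp (-x ^ 2 / 2) ≤ exp (-s ^ 2 / 2) * exp (-(x + (t - s)) ^ 2 / 2) := by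
    rw [← exp_add, ← exp_add, exp_le_exp]
    nlinarith [mul_nonneg (sub_nonneg.2 hst) (sub_nonneg.2 (mem_Iic.1 hx))]
  calc _ = (√(2 * π))⁻¹ ^ 2 * (exp (-t ^ 2 / 2) * exp (-x ^ 2 / 2)) := by ring
    _ ≤ (√(2 * π))⁻¹ ^ 2 * (exp (-s ^ 2 / 2) * exp (-(x + (t - s)) ^ 2 / 2)) := by gcongr
    _ = _ := by ring

theorem concaveOn_log_cdf : ConcaveOn ℝ univ fun t => log (cdf (gaussianReal 0 1) t) := by
  have hd (t : ℝ) := (hasDerivAt_cdf_gaussian t).log (cdf_gaussian_pos t).ne'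
  refine AntitoneOn.concaveOn_of_deriv convex_univ
    (fun t _ => (hd t).continuousAt.continuousWithinAt)
    (fun t _ => (hd t).differentiableAt.differentiableWithinAt) fun s _ t _ hst => ?_
  rw [(hd s).deriv, (hd t).deriv, div_le_div_iff₀ (cdf_gaussian_pos _) (cdf_gaussian_pos _)]
  exact gaussianPDFReal_mul_cdf_le hst

theorem cdf_le_tangent (t y : ℝ) :
    cdf (gaussianReal 0 1) (t + y) ≤ cdf (gaussianReal 0 1) t *
      exp (gaussianPDFReal 0 1 t / cdf (gaussianReal 0 1) t * y) := by
  have hd := (hasDerivAt_cdf_gaussian t).log (cdf_gaussian_pos t).ne'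
  rw [← log_le_log_iff (cdf_gaussian_pos _) (by have := cdf_gaussian_pos t; positivity),
    log_mul (cdf_gaussian_pos _).ne' (exp_ne_zero _), log_exp]
  rcases lt_trichotomy y 0 with hy | rfl | hy
  · have := concaveOn_log_cdf.le_slope_of_hasDerivAt (x := t + y) (y := t) (mem_univ _)
      (mem_univ _) (by linarith) hd
    rw [slope_def_field, le_div_iff₀ (by linarith)] at this
    linarith
  · simp
  · have := concaveOn_log_cdf.slope_le_of_hasDerivAt (x := t) (y := t + y) (mem_univ _)
      (mem_univ _) (by linarith) hd
    rw [slope_def_field, div_le_iff₀ (by linarith)] at this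
    linarith

theorem cdf_neg_threshold {p : ℝ} (hp : p ∈ Ioo (0 : ℝ) (1 / 2)) :
    cdf (gaussianReal 0 1) (-threshold p) = p := by
  rw [cdf_eq_real]
  exact ((threshold_spec hp).2 _).2 rfl

theorem gaussianPDFReal_neg (x : ℝ) : gaussianPDFReal 0 1 (-x) = gaussianPDFReal 0 1 x := by
  simp [gaussianPDFReal_zero_one]

/-- The tangent line to the concave function log Φ at -c has slope a/p. Having the bound for y of
both signs matters: the tilted thresholds below may lie on either side of -c. -/
theorem cdf_tail_le {p : ℝ} (hp : p ∈ Ioo (0 : ℝ) (1 / 2)) (y : ℝ) :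
    cdf (gaussianReal 0 1) (-threshold p - y) ≤ p * exp (-(aConst p / p * y)) := by
  have := cdf_le_tangent (-threshold p) (-y)
  rwa [cdf_neg_threshold hp, gaussianPDFReal_neg, mul_neg, ← sub_eq_add_neg] at this

theorem aConst_pos (p : ℝ) : 0 < aConst p := gaussianPDFReal_pos _ _ _ one_ne_zero

/-! ### The conditional variance -/

theorem tendsto_pow_mul_gaussianPDFReal_atBot (n : ℕ) :
    Filter.Tendsto (fun x => x ^ n * gaussianPDFReal 0 1 x) Filter.atBot (nhds 0) := by
  have h := (tendsto_rpow_abs_mul_exp_neg_mul_sq_cocompact (a := 1 / 2) (by norm_num)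
    (n : ℝ)).mono_left (atBot_le_cocompact)
  have h2 := h.const_mul (√(2 * π))⁻¹
  rw [mul_zero] at h2
  refine squeeze_zero_norm (fun x => le_of_eq ?_) h2
  rw [gaussianPDFReal_zero_one, rpow_natCast, norm_mul, norm_mul, norm_pow, norm_eq_abs,
    norm_of_nonneg (exp_pos _).le, norm_of_nonneg (by positivity : 0 ≤ (√(2 * π))⁻¹)]
  ring_nf

theorem integrable_pow_mul_gaussianPDFReal (n : ℕ) :
    Integrable fun x => x ^ n * gaussianPDFReal 0 1 x := by
  have h := (integrable_rpow_mul_exp_neg_mul_sq (b := 1 / 2) (by norm_num) (s := n)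
    (by have := n.cast_nonneg (α := ℝ); linarith)).const_mul (√(2 * π))⁻¹
  refine h.congr (.of_forall fun x => ?_)
  simp only [rpow_natCast, gaussianPDFReal_zero_one]
  ring_nf

theorem setIntegral_Iic_id_mul_gaussianPDFReal (t : ℝ) :
    ∫ x in Iic t, x * gaussianPDFReal 0 1 x = -gaussianPDFReal 0 1 t := by
  have h := integral_Iic_of_hasDerivAt_of_tendsto' (a := t) (f := fun x => -gaussianPDFReal 0 1 x)
    (f' := fun x => x * gaussianPDFReal 0 1 x) (m := 0)
    (fun x _ => by convert! (hasDerivAt_gaussianPDFReal x).neg using 1; ring)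
    (by simpa using (integrable_pow_mul_gaussianPDFReal 1).integrableOn)
    (by simpa using (tendsto_pow_mul_gaussianPDFReal_atBot 0).neg)
  simpa using h

theorem setIntegral_Iic_sq_mul_gaussianPDFReal (t : ℝ) :
    ∫ x in Iic t, x ^ 2 * gaussianPDFReal 0 1 x =
      cdf (gaussianReal 0 1) t - t * gaussianPDFReal 0 1 t := by
  have hi := (integrable_pow_mul_gaussianPDFReal 2).integrableOn (s := Iic t)
  have hi0 := (integrable_gaussianPDFReal 0 1).integrableOn (s := Iic t)
  have h := integral_Iic_of_hasDerivAt_of_tendsto' (a := t)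
    (f := fun x => -(x * gaussianPDFReal 0 1 x))
    (f' := fun x => x ^ 2 * gaussianPDFReal 0 1 x - gaussianPDFReal 0 1 x) (m := 0)
    (fun x _ => by
      convert! ((hasDerivAt_id x).mul (hasDerivAt_gaussianPDFReal x)).neg using 1
      simp
      ring)
    (hi.sub hi0)
    (by simpa using (tendsto_pow_mul_gaussianPDFReal_atBot 1).neg)
  rw [integral_sub hi hi0, ← cdf_gaussian_eq_integral] at h
  linarith

theorem integral_cond_gaussian (t : ℝ) (f : ℝ → ℝ) :
    ∫ x, f x ∂(cond (gaussianReal 0 1) (Iic t)) =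
      (cdf (gaussianReal 0 1) t)⁻¹ * ∫ x in Iic t, f x * gaussianPDFReal 0 1 x := by
  rw [ProbabilityTheory.cond, integral_smul_measure, cdf_eq_real, measureReal_def, ENNReal.toReal_inv, smul_eq_mul,
    ← integral_indicator measurableSet_Iic, integral_gaussianReal_eq_integral_smul one_ne_zero,
    ← integral_indicator measurableSet_Iic]
  congr 2
  ext x
  by_cases hx : x ∈ Iic t <;> simp [hx, mul_comm]

/-- The ratio a/p is -E[Z ∣ Z ≤ -c], and the mean over a half-line lies strictly inside it. -/
theorem threshold_lt_ratio {p : ℝ} (hp : p ∈ Ioo (0 : ℝ) (1 / 2)) :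
    threshold p < aConst p / p := by
  set c := threshold p
  have hi1 : IntegrableOn (fun x => x * gaussianPDFReal 0 1 x) (Iic (-c)) := by
    simpa using (integrable_pow_mul_gaussianPDFReal 1).integrableOn
  have hi0 := (integrable_gaussianPDFReal 0 1).integrableOn (s := Iic (-c))
  have key : 0 < ∫ x in Iic (-c), (-c * gaussianPDFReal 0 1 x - x * gaussianPDFReal 0 1 x) := by
    rw [setIntegral_pos_iff_support_of_nonneg_ae]
    · refine lt_of_lt_of_le ?_ (measure_mono (s := Iio (-c)) fun x hx => ⟨?_, Iio_subset_Iic_self hx⟩)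
      · simp
      · have := mul_pos (sub_pos.2 (mem_Iio.1 hx)) (gaussianPDFReal_pos 0 1 x one_ne_zero)
        rw [Function.mem_support, ← sub_mul]
        exact this.ne'
    · refine (ae_restrict_iff' measurableSet_Iic).2 (.of_forall fun x hx => ?_)
      simp only [Pi.zero_apply]
      rw [← sub_mul]
      exact mul_nonneg (sub_nonneg.2 hx) (gaussianPDFReal_nonneg _ _ _)
    · exact (hi0.const_mul _).sub hi1
  rw [integral_sub (hi0.const_mul _) hi1, integral_const_mul, ← cdf_gaussian_eq_integral,
    setIntegral_Iic_id_mul_gaussianPDFReal, cdf_neg_threshold hp, gaussianPDFReal_neg] at key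
  rw [lt_div_iff₀ hp.1, aConst]
  linarith

/-- With m = a/p, the conditional first and second moments are -m and 1 + cm, by φ' = -xφ and
integration by parts. -/
theorem gammaConst_eq {p : ℝ} (hp : p ∈ Ioo (0 : ℝ) (1 / 2)) :
    gammaConst p = aConst p / p * (aConst p / p - threshold p) := by
  have hne : gaussianReal 0 1 (Iic (-threshold p)) ≠ 0 := by
    intro h
    have := cdf_gaussian_pos (-threshold p)
    rw [cdf_eq_real, measureReal_def, h] at this
    simp at this
  have : IsProbabilityMeasure (cond (gaussianReal 0 1) (Iic (-threshold p))) :=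
    cond_isProbabilityMeasure hne
  have hL : MemLp id 2 (cond (gaussianReal 0 1) (Iic (-threshold p))) := by
    refine MemLp.smul_measure ((memLp_id_gaussianReal (μ := 0) (v := 1) 2).restrict _) ?_
    exact ENNReal.inv_ne_top.2 hne
  rw [gammaConst, variance_eq_sub hL]
  simp only [Pi.pow_apply, id]
  rw [integral_cond_gaussian, integral_cond_gaussian _ (fun x => x),
    setIntegral_Iic_sq_mul_gaussianPDFReal, setIntegral_Iic_id_mul_gaussianPDFReal,
    cdf_neg_threshold hp, gaussianPDFReal_neg, ← aConst]
  have := hp.1.ne'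
  field_simp
  ring

theorem gammaConst_pos {p : ℝ} (hp : p ∈ Ioo (0 : ℝ) (1 / 2)) : 0 < gammaConst p := by
  rw [gammaConst_eq hp]
  exact mul_pos (div_pos (aConst_pos p) hp.1) (sub_pos.2 (threshold_lt_ratio hp))

theorem betaQuad_pos {p : ℝ} (hp : p ∈ Ioo (0 : ℝ) (1 / 2)) : 0 < betaQuad p := by
  have := gammaConst_pos hp
  have := aConst_pos p
  have := hp.1
  rw [betaQuad]
  positivity

/-! ### Exponential tilts of the standard normal law -/

/-- Completing the square: the quadratic tilt κ changes the variance from 1 to σ² = 1/(1 - κ), and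
the linear tilt θ moves the mean to θσ². -/
theorem exp_tilt_mul_gaussianPDFReal {κ σ : ℝ} (hσ : 0 < σ) (hκ : σ ^ 2 * (1 - κ) = 1) (θ x : ℝ) :
    gaussianPDFReal 0 1 x * exp (θ * x + κ / 2 * x ^ 2) = σ * exp (θ ^ 2 * σ ^ 2 / 2) *
      gaussianPDFReal (θ * σ ^ 2) (σ ^ 2).toNNReal x := by
  have h2 : (2 * π * σ ^ 2) = σ ^ 2 * (2 * π) := by ring
  rw [gaussianPDFReal_zero_one, gaussianPDFReal, Real.coe_toNNReal _ (sq_nonneg σ), h2,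
    sqrt_mul (sq_nonneg σ), sqrt_sq hσ.le, mul_inv]
  have hexp : exp (-x ^ 2 / 2) * exp (θ * x + κ / 2 * x ^ 2) =
      exp (θ ^ 2 * σ ^ 2 / 2) * exp (-(x - θ * σ ^ 2) ^ 2 / (2 * σ ^ 2)) := by
    rw [← exp_add, ← exp_add]
    congr 1
    have hκ' : κ = 1 - 1 / σ ^ 2 := by field_simp; linarith
    rw [hκ']
    field_simp
    ring
  calc _ = (√(2 * π))⁻¹ * (exp (-x ^ 2 / 2) * exp (θ * x + κ / 2 * x ^ 2)) := by ring
    _ = _ := by rw [hexp]; field_simp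

theorem lintegral_Iio_exp_tilt {κ σ : ℝ} (hσ : 0 < σ) (hκ : σ ^ 2 * (1 - κ) = 1) (θ u : ℝ) :
    ∫⁻ x in Iio u, ENNReal.ofReal (exp (θ * x + κ / 2 * x ^ 2)) ∂gaussianReal 0 1 ≤
      ENNReal.ofReal (σ * exp (θ ^ 2 * σ ^ 2 / 2) *
        cdf (gaussianReal 0 1) ((u - θ * σ ^ 2) / σ)) := by
  have hv : (σ ^ 2).toNNReal ≠ 0 := by simpa using hσ.ne'
  have hmap : gaussianReal (θ * σ ^ 2) (σ ^ 2).toNNReal =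
      (gaussianReal 0 1).map fun x => σ * x + θ * σ ^ 2 := by
    have h := gaussianReal_map_add_const (μ := σ * 0) (v := .mk (σ ^ 2) (sq_nonneg σ) * 1) (θ * σ ^ 2)
    rw [← gaussianReal_map_const_mul, Measure.map_map (by fun_prop) (by fun_prop)] at h
    rw [show (fun x => σ * x + θ * σ ^ 2) = (fun x => x + θ * σ ^ 2) ∘ fun x => σ * x from rfl, h]
    congr 1
    · ring
    · ext; simp [sq_nonneg]
  calc _ = ∫⁻ x in Iio u, ENNReal.ofReal (σ * exp (θ ^ 2 * σ ^ 2 / 2)) *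
        gaussianPDF (θ * σ ^ 2) (σ ^ 2).toNNReal x := by
        rw [gaussianReal_of_var_ne_zero _ one_ne_zero, restrict_withDensity measurableSet_Iio,
          lintegral_withDensity_eq_lintegral_mul _ (measurable_gaussianPDF _ _) (by fun_prop)]
        refine lintegral_congr fun x => ?_
        rw [Pi.mul_apply, gaussianPDF, gaussianPDF, ← ENNReal.ofReal_mul (gaussianPDFReal_nonneg _ _ _),
          exp_tilt_mul_gaussianPDFReal hσ hκ, ENNReal.ofReal_mul (by positivity)]
    _ = ENNReal.ofReal (σ * exp (θ ^ 2 * σ ^ 2 / 2)) *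
        gaussianReal (θ * σ ^ 2) (σ ^ 2).toNNReal (Iio u) := by
        rw [lintegral_const_mul _ (measurable_gaussianPDF _ _), gaussianReal_apply _ hv]
    _ ≤ _ := by
        rw [ENNReal.ofReal_mul (q := cdf _ _) (by positivity), hmap, Measure.map_apply (by fun_prop)
          measurableSet_Iio, cdf_eq_real, ofReal_measureReal]
        refine mul_le_mul_right (measure_mono ?_) _
        intro x hx
        rw [mem_preimage, mem_Iio] at hx
        rw [mem_Iic, le_div_iff₀ hσ]
        linarith

/-! ### Integrating out one column of inner products -/

theorem measurable_fin_cons {α : Type*} [MeasurableSpace α] {n : ℕ} :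
    Measurable fun q : α × (Fin n → α) => (Fin.cons q.1 q.2 : Fin (n + 1) → α) :=
  measurable_pi_iff.2 fun i => by
    refine Fin.cases ?_ (fun j => ?_) i
    · simpa using measurable_fst
    · exact (measurable_pi_apply j).comp measurable_snd

theorem lintegral_pi_succ {α : Type*} [MeasurableSpace α] {n : ℕ} (μ : Fin (n + 1) → Measure α)
    [∀ i, SigmaFinite (μ i)] {f : (Fin (n + 1) → α) → ENNReal} (hf : Measurable f) :
    ∫⁻ x, f x ∂Measure.pi μ =
      ∫⁻ x, ∫⁻ y, f (Fin.cons x y) ∂Measure.pi (fun i => μ i.succ) ∂μ 0 := by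
  have h := (measurePreserving_piFinSuccAbove μ 0).symm
  have hcons (q : α × (Fin n → α)) :
      (MeasurableEquiv.piFinSuccAbove (fun _ => α) 0).symm q = Fin.cons q.1 q.2 := by
    simp [MeasurableEquiv.piFinSuccAbove, Fin.insertNthEquiv]
  rw [← h.lintegral_comp hf]
  simp only [Fin.succAbove_zero, hcons]
  exact lintegral_prod _ (hf.comp measurable_fin_cons).aemeasurable

theorem lintegral_pi_succ_swap {α : Type*} [MeasurableSpace α] {n : ℕ}
    (μ : Fin (n + 1) → Measure α)
    [∀ i, SigmaFinite (μ i)] {f : (Fin (n + 1) → α) → ENNReal} (hf : Measurable f) :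
    ∫⁻ x, f x ∂Measure.pi μ =
      ∫⁻ y, ∫⁻ x, f (Fin.cons x y) ∂μ 0 ∂Measure.pi (fun i => μ i.succ) := by
  rw [lintegral_pi_succ μ hf, lintegral_lintegral_swap]
  exact (hf.comp measurable_fin_cons).aemeasurable

/-- The cut-off exponential of a triangular quadratic form in the coordinates of a column. -/
noncomputable def columnWeight {n : ℕ} (t u : Fin n → ℝ) (β k : ℝ) (g : Fin n → ℝ) : ENNReal :=
  open Classical in
  if ∀ i, g i < -u i then ENNReal.ofReal (exp
    (-(∑ j, ∑ i, if j < i then t j * (g j * g i) else 0) + β * ∑ i, g i + k / 2 * ∑ i, g i ^ 2))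
  else 0

theorem measurable_columnWeight_prod {n : ℕ} (u : Fin n → ℝ) (β k : ℝ) :
    Measurable fun q : (Fin n → ℝ) × (Fin n → ℝ) => columnWeight q.1 u β k q.2 := by
  classical
  refine Measurable.ite ?_ ?_ measurable_const
  · simp only [ofPred_forall]
    exact MeasurableSet.iInter fun i => measurableSet_lt (by fun_prop) measurable_const
  · refine ENNReal.measurable_ofReal.comp (Continuous.measurable ?_)
    refine continuous_exp.comp (.add (.add (.neg ?_) (by fun_prop)) (by fun_prop))
    refine continuous_finsetSum _ fun j _ => continuous_finsetSum _ fun i _ => ?_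
    split_ifs <;> fun_prop

theorem measurable_columnWeight {n : ℕ} (t u : Fin n → ℝ) (β k : ℝ) :
    Measurable (columnWeight t u β k) :=
  (measurable_columnWeight_prod u β k).comp measurable_prodMk_left

/-- Any k ≤ κ is allowed, so that one σ serves every stage of the recursion although the quadratic
tilt grows along it. -/
theorem lintegral_Iio_exp_tilt_le {p c m σ κ : ℝ} (hσ : 0 < σ)
    (hκ : σ ^ 2 * (1 - κ) = 1)
    (htail : ∀ y, cdf (gaussianReal 0 1) (-c - y) ≤ p * exp (-(m * y))) {k : ℝ} (hk : k ≤ κ)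
    (θ u : ℝ) :
    ∫⁻ x in Iio (-u), ENNReal.ofReal (exp (θ * x + k / 2 * x ^ 2)) ∂gaussianReal 0 1 ≤
      ENNReal.ofReal (σ * exp (θ ^ 2 * σ ^ 2 / 2) * (p * exp (m * (c - u / σ) - m * σ * θ))) := by
  calc _ ≤ ∫⁻ x in Iio (-u), ENNReal.ofReal (exp (θ * x + κ / 2 * x ^ 2)) ∂gaussianReal 0 1 := by
        gcongr
    _ ≤ _ := lintegral_Iio_exp_tilt hσ hκ θ (-u)
    _ ≤ _ := by
        refine ENNReal.ofReal_le_ofReal (mul_le_mul_of_nonneg_left ?_ (by positivity))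
        have h := htail (u / σ + θ * σ - c)
        have e1 : -c - (u / σ + θ * σ - c) = (-u - θ * σ ^ 2) / σ := by field_simp; ring
        have e2 : -(m * (u / σ + θ * σ - c)) = m * (c - u / σ) - m * σ * θ := by ring
        rwa [e1, e2] at h

/-- Integrating out g₀, with G the sum of the other coordinates, is a tilted tail integral with θ =
β - t₀G. The tail bound yields exp(-mσβ + mσt₀G), so g₀ is in effect replaced by -mσ and β grows by
mσt₀ for the remaining coordinates. The factor exp(θ²σ²/2) is absorbed into a constant and an
increase of k. The bounds `B` and `κ` are budgets for the final values of β and k. -/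
theorem lintegral_columnWeight_le {p c m σ κ T B : ℝ} {N : ℕ} (hp : 0 < p) (hm : 0 ≤ m)
    (hσ : 0 < σ) (hκ : σ ^ 2 * (1 - κ) = 1) (hT : 0 ≤ T)
    (htail : ∀ y, cdf (gaussianReal 0 1) (-c - y) ≤ p * exp (-(m * y))) :
    ∀ (n : ℕ) (_ : n ≤ N) (t u : Fin n → ℝ) (_ : ∀ j, 0 ≤ t j ∧ t j ≤ T) (β k : ℝ) (_ : 0 ≤ β)
      (_ : β + m * σ * n * T ≤ B) (_ : k + n * (2 * σ ^ 2 * T ^ 2 * N) ≤ κ),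
      ∫⁻ g, columnWeight t u β k g ∂Measure.pi (fun _ => gaussianReal 0 1) ≤
        ENNReal.ofReal (exp (∑ i, (log p + log σ + σ ^ 2 * B ^ 2 + m * (c - u i / σ)) -
          m * σ * n * β - m ^ 2 * σ ^ 2 * ∑ j : Fin n, ((n : ℝ) - 1 - j) * t j)) := by
  intro n
  induction n with
  | zero =>
    intro _ t u _ β k _ _ _
    simp [columnWeight]
  | succ n ih =>
    intro hn t u ht β k hβ hB hk
    push_cast at hB hk
    have hX : 0 ≤ 2 * σ ^ 2 * T ^ 2 * N := by positivity
    have hnX : 0 ≤ n * (2 * σ ^ 2 * T ^ 2 * N) := by positivity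
    have hmσ : 0 ≤ m * σ := by positivity
    have hmT : 0 ≤ m * σ * n * T := by positivity
    have hmT1 : 0 ≤ m * σ * T := by positivity
    have ht0 := ht 0
    have hmt : m * σ * t 0 ≤ m * σ * T := mul_le_mul_of_nonneg_left ht0.2 hmσ
    rw [lintegral_pi_succ_swap _ (measurable_columnWeight t u β k)]
    set A : ℝ := log p + log σ + σ ^ 2 * B ^ 2 + m * (c - u 0 / σ) - m * σ * β with hA
    have key (y : Fin n → ℝ) :
        ∫⁻ x, columnWeight t u β k (Fin.cons x y : Fin (n + 1) → ℝ) ∂gaussianReal 0 1 ≤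
          ENNReal.ofReal (exp A) * columnWeight (fun i => t i.succ) (fun i => u i.succ)
            (β + m * σ * t 0) (k + 2 * σ ^ 2 * T ^ 2 * N) y := by
      by_cases hy : ∀ i : Fin n, y i < -u i.succ
      swap
      · have h0 (x : ℝ) : columnWeight t u β k (Fin.cons x y : Fin (n + 1) → ℝ) = 0 := by
          rw [columnWeight, if_neg]
          exact fun h => hy fun i => by simpa using h i.succ
        simp [h0]
      set G := ∑ i, y i with hG
      set Q := ∑ i, y i ^ 2 with hQ
      have hQ0 : 0 ≤ Q := Finset.sum_nonneg fun i _ => sq_nonneg _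
      set W := ∑ j : Fin n, ∑ i : Fin n, if j < i then t j.succ * (y j * y i) else 0 with hW
      have e (x : ℝ) : columnWeight t u β k (Fin.cons x y : Fin (n + 1) → ℝ) =
          (Iio (-u 0)).indicator (fun x => ENNReal.ofReal (exp (-W + β * G + k / 2 * Q)) *
            ENNReal.ofReal (exp ((β - t 0 * G) * x + k / 2 * x ^ 2))) x := by
        have hiff : (∀ i, (Fin.cons x y : Fin (n + 1) → ℝ) i < -u i) ↔ x ∈ Iio (-u 0) := by
          rw [Fin.forall_fin_succ]
          simpa using fun _ => hy
        rw [columnWeight]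
        by_cases hx : x ∈ Iio (-u 0)
        · rw [if_pos (hiff.2 hx), indicator_of_mem hx, ← ENNReal.ofReal_mul (exp_pos _).le,
            ← exp_add]
          congr 2
          simp only [Fin.sum_univ_succ, Fin.cons_zero, Fin.cons_succ, Fin.succ_lt_succ_iff,
            Fin.succ_pos, Fin.not_lt_zero, if_true, if_false, zero_add]
          rw [← hW, ← hG, ← hQ, ← Finset.mul_sum, ← Finset.mul_sum, ← hG]
          ring
        · rw [if_neg (mt hiff.1 hx), indicator_of_notMem hx]
      simp_rw [e]
      rw [lintegral_indicator measurableSet_Iio, lintegral_const_mul _ (by fun_prop), columnWeight,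
        if_pos hy]
      refine (mul_le_mul_right (lintegral_Iio_exp_tilt_le hσ hκ htail (by linarith) _ _) _).trans ?_
      rw [← ENNReal.ofReal_mul (exp_pos _).le, ← ENNReal.ofReal_mul (exp_pos _).le]
      refine ENNReal.ofReal_le_ofReal ?_
      -- Cauchy–Schwarz turns the square of the sum into a diagonal quadratic form, the only kind of
      -- quadratic tilt that the induction carries.
      have hGQ : G ^ 2 ≤ n * Q := by
        simpa using sq_sum_le_card_mul_sum_sq (s := Finset.univ) (f := y)
      have hθ : (β - t 0 * G) ^ 2 * σ ^ 2 / 2 ≤ σ ^ 2 * B ^ 2 + σ ^ 2 * T ^ 2 * N * Q := by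
        have h1 : (β - t 0 * G) ^ 2 ≤ 2 * β ^ 2 + 2 * (t 0 ^ 2 * G ^ 2) := by
          nlinarith [sq_nonneg (β + t 0 * G)]
        have h2 : t 0 ^ 2 * G ^ 2 ≤ T ^ 2 * (N * Q) := by
          have hnN : (n : ℝ) ≤ N := by exact_mod_cast (Nat.le_succ n).trans hn
          refine mul_le_mul (pow_le_pow_left₀ ht0.1 ht0.2 2) ?_ (sq_nonneg _) (sq_nonneg _)
          exact hGQ.trans (mul_le_mul_of_nonneg_right hnN hQ0)
        have h3 : β ^ 2 ≤ B ^ 2 := pow_le_pow_left₀ hβ (by linarith) 2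
        have h4 : (β - t 0 * G) ^ 2 ≤ 2 * (B ^ 2 + T ^ 2 * N * Q) := by linarith
        nlinarith [mul_le_mul_of_nonneg_left h4 (sq_nonneg σ)]
      have hpσ : σ * exp ((β - t 0 * G) ^ 2 * σ ^ 2 / 2) *
          (p * exp (m * (c - u 0 / σ) - m * σ * (β - t 0 * G))) =
          exp (log σ + (β - t 0 * G) ^ 2 * σ ^ 2 / 2 +
            (log p + (m * (c - u 0 / σ) - m * σ * (β - t 0 * G)))) := by
        rw [exp_add, exp_add, exp_add (log p), exp_log hσ, exp_log hp]
      rw [hpσ, ← exp_add, ← exp_add, exp_le_exp, hA, ← hW]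
      nlinarith [hθ]
    calc _ ≤ ∫⁻ y, ENNReal.ofReal (exp A) * columnWeight (fun i => t i.succ) (fun i => u i.succ)
            (β + m * σ * t 0) (k + 2 * σ ^ 2 * T ^ 2 * N) y
            ∂Measure.pi (fun _ => gaussianReal 0 1) := lintegral_mono key
      _ = ENNReal.ofReal (exp A) * ∫⁻ y, columnWeight (fun i => t i.succ) (fun i => u i.succ)
            (β + m * σ * t 0) (k + 2 * σ ^ 2 * T ^ 2 * N) y
            ∂Measure.pi (fun _ => gaussianReal 0 1) :=
          lintegral_const_mul _ (measurable_columnWeight _ _ _ _)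
      _ ≤ _ := mul_le_mul_right (ih ((Nat.le_succ n).trans hn) _ _ (fun j => ht j.succ) _ _
            (add_nonneg hβ (mul_nonneg hmσ ht0.1)) (by linarith) (by linarith)) _
      _ = _ := by
          rw [← ENNReal.ofReal_mul (exp_pos _).le, ← exp_add]
          congr 2
          rw [Fin.sum_univ_succ, Fin.sum_univ_succ (f := fun j : Fin (n + 1) => _ * t j), hA]
          have : ∑ i : Fin n, (((n + 1 : ℕ) : ℝ) - 1 - (i.succ : ℕ)) * t i.succ =
              ∑ i : Fin n, ((n : ℝ) - 1 - i) * t i.succ :=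
            Finset.sum_congr rfl fun i _ => by push_cast [Fin.val_succ]; ring
          rw [this]
          push_cast [Fin.val_zero]
          ring

/-! ### Standard Gaussian vectors and the chi-squared law -/

section Decomposition

variable {E : Type*} [NormedAddCommGroup E] [InnerProductSpace ℝ E] [FiniteDimensional ℝ E]
  [MeasurableSpace E] [BorelSpace E]

/-- A standard Gaussian vector is the independent sum of a standard Gaussian multiple of a unit
vector and a standard Gaussian vector of the orthogonal complement. -/
theorem stdGaussian_eq_map_prod {e : E} (he : ‖e‖ = 1) :
    ((gaussianReal 0 1).prod (stdGaussian (Submodule.span ℝ {e})ᗮ)).map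
      (fun q => q.1 • e + (q.2 : E)) = stdGaussian E := by
  apply Measure.ext_of_charFun
  ext t
  rw [charFun_stdGaussian, charFun_apply, integral_map (by fun_prop)
    (Measurable.aestronglyMeasurable (by fun_prop))]
  set W := (Submodule.span ℝ {e})ᗮ with hW
  have hin (z : W) : inner ℝ (z : E) t = inner ℝ z (W.orthogonalProjectionOnto t) := by
    rw [Submodule.inner_orthogonalProjectionOnto_eq_of_mem_left]
  have hsplit (q : ℝ × W) : Complex.exp (inner ℝ (q.1 • e + (q.2 : E)) t * Complex.I) =
      Complex.exp (inner ℝ q.1 (inner ℝ e t) * Complex.I) *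
        Complex.exp (inner ℝ q.2 (W.orthogonalProjectionOnto t) * Complex.I) := by
    rw [inner_add_left, real_inner_smul_left, hin, ← Complex.exp_add]
    congr 1
    simp
    ring
  simp_rw [hsplit]
  rw [integral_prod_mul (fun x : ℝ => Complex.exp (inner ℝ x (inner ℝ e t) * Complex.I))
    (fun z : W => Complex.exp (inner ℝ z (W.orthogonalProjectionOnto t) * Complex.I)),
    ← charFun_apply, ← charFun_apply, charFun_stdGaussian, charFun_gaussianReal,
    ← Complex.exp_add]
  congr 1
  have hn : ‖t‖ ^ 2 = (inner ℝ e t) ^ 2 + ‖W.orthogonalProjectionOnto t‖ ^ 2 := by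
    rw [Submodule.norm_sq_eq_add_norm_sq_projection t (Submodule.span ℝ {e})]
    congr 1
    rw [← Submodule.norm_coe, Submodule.coe_orthogonalProjectionOnto_apply,
      Submodule.starProjection_unit_singleton ℝ he, norm_smul, he, mul_one, norm_eq_abs, sq_abs]
  have hn' := congrArg (fun x : ℝ => (x : ℂ)) hn
  push_cast at hn'
  rw [hn']
  push_cast
  ring

omit [MeasurableSpace E] [BorelSpace E] in
theorem finrank_orthogonal_span_unit {e : E} (he : ‖e‖ = 1) :
    Module.finrank ℝ (Submodule.span ℝ {e})ᗮ = Module.finrank ℝ E - 1 := by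
  have h := (Submodule.span ℝ {e}).finrank_add_finrank_orthogonal
  rw [finrank_span_singleton (by rintro rfl; simp at he)] at h
  omega

end Decomposition

/-- The chi-squared law with `k` degrees of freedom. -/
noncomputable def chiSq (k : ℕ) : Measure ℝ :=
  (stdGaussian (EuclideanSpace ℝ (Fin k))).map fun y => ‖y‖ ^ 2

instance (k : ℕ) : IsProbabilityMeasure (chiSq k) :=
  Measure.isProbabilityMeasure_map (Measurable.aemeasurable (by fun_prop))

theorem map_norm_sq_stdGaussian {E : Type*} [NormedAddCommGroup E] [InnerProductSpace ℝ E]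
    [FiniteDimensional ℝ E] [MeasurableSpace E] [BorelSpace E] :
    (stdGaussian E).map (fun y => ‖y‖ ^ 2) = chiSq (Module.finrank ℝ E) := by
  rw [chiSq, ← stdGaussian_map (stdOrthonormalBasis ℝ E).repr,
    Measure.map_map (by fun_prop) (by fun_prop)]
  congr 1
  ext y
  simp

theorem lintegral_exp_tilt {κ σ : ℝ} (hσ : 0 < σ) (hκ : σ ^ 2 * (1 - κ) = 1) :
    ∫⁻ x, ENNReal.ofReal (exp (κ / 2 * x ^ 2)) ∂gaussianReal 0 1 = ENNReal.ofReal σ := by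
  have hv : (σ ^ 2).toNNReal ≠ 0 := by simpa using hσ.ne'
  rw [gaussianReal_of_var_ne_zero _ one_ne_zero,
    lintegral_withDensity_eq_lintegral_mul _ (measurable_gaussianPDF _ _) (by fun_prop)]
  calc _ = ∫⁻ x, ENNReal.ofReal σ * gaussianPDF 0 (σ ^ 2).toNNReal x := by
        refine lintegral_congr fun x => ?_
        have h := exp_tilt_mul_gaussianPDFReal hσ hκ 0 x
        rw [Pi.mul_apply, gaussianPDF, gaussianPDF, ← ENNReal.ofReal_mul (gaussianPDFReal_nonneg _ _ _),
          ← ENNReal.ofReal_mul hσ.le]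
        congr 1
        simpa using h
    _ = _ := by
        rw [lintegral_const_mul _ (measurable_gaussianPDF _ _), lintegral_gaussianPDF_eq_one _ hv,
          mul_one]

theorem lintegral_pi_exp_sum_sq {κ σ : ℝ} (hσ : 0 < σ) (hκ : σ ^ 2 * (1 - κ) = 1) (k : ℕ) :
    ∫⁻ x : Fin k → ℝ, ENNReal.ofReal (exp (κ / 2 * ∑ i, x i ^ 2))
      ∂Measure.pi (fun _ => gaussianReal 0 1) = ENNReal.ofReal σ ^ k := by
  induction k with
  | zero => simp
  | succ k ih =>
    rw [lintegral_pi_succ _ (by fun_prop)]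
    simp_rw [Fin.sum_univ_succ, Fin.cons_zero, Fin.cons_succ, mul_add, exp_add,
      ENNReal.ofReal_mul (exp_pos _).le]
    simp_rw [lintegral_const_mul' _ _ ENNReal.ofReal_ne_top, ih]
    rw [lintegral_mul_const _ (by fun_prop), lintegral_exp_tilt hσ hκ, pow_succ']

/-- The moment generating function is (1 - κ)^(-k/2) with κ = τ/d. Centring at d ≥ k cancels the
linear term, leaving τ²/d; fewer degrees of freedom only help. -/
theorem lintegral_chiSq_exp_le {k d : ℕ} (hkd : k ≤ d) (hd : 0 < d) {τ : ℝ} (h0 : 0 ≤ τ)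
    (hτ : τ ≤ d / 2) :
    ∫⁻ s, ENNReal.ofReal (exp (τ * ((s / d - 1) / 2))) ∂chiSq k ≤
      ENNReal.ofReal (exp (τ ^ 2 / d)) := by
  have hd' : (0 : ℝ) < d := by exact_mod_cast hd
  set κ : ℝ := τ / d with hκdef
  have hκ0 : 0 ≤ κ := by positivity
  have hκ2 : κ ≤ 1 / 2 := by rw [hκdef, div_le_iff₀ hd']; linarith
  set σ : ℝ := (√(1 - κ))⁻¹ with hσdef
  have hσ : 0 < σ := inv_pos.2 (sqrt_pos.2 (by linarith))
  have hσ2 : σ ^ 2 = (1 - κ)⁻¹ := by rw [hσdef, inv_pow, sq_sqrt (by linarith)]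
  have hκ : σ ^ 2 * (1 - κ) = 1 := by rw [hσ2]; exact inv_mul_cancel₀ (by linarith)
  have hσle : σ ≤ exp (κ / 2 + κ ^ 2) := by
    refine (sq_le_sq₀ hσ.le (exp_pos _).le).1 ?_
    rw [hσ2, inv_le_iff_one_le_mul₀ (by linarith), ← exp_nat_mul]
    -- It suffices that (1 + κ + 2κ²)(1 - κ) = 1 + κ²(1 - 2κ) ≥ 1.
    have := add_one_le_exp ((2 : ℕ) * (κ / 2 + κ ^ 2))
    push_cast at this ⊢
    nlinarith [mul_le_mul_of_nonneg_right this (by linarith : 0 ≤ 1 - κ), sq_nonneg κ,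
      mul_nonneg (sq_nonneg κ) (by linarith : 0 ≤ 1 - 2 * κ)]
  have h1σ : 1 ≤ σ := by
    refine (sq_le_sq₀ zero_le_one hσ.le).1 ?_
    rw [hσ2, one_pow, one_le_inv₀ (by linarith)]
    linarith
  rw [chiSq, lintegral_map (by fun_prop) (by fun_prop), ← map_pi_eq_stdGaussian,
    lintegral_map (by fun_prop) (by fun_prop)]
  calc _ = ∫⁻ x : Fin k → ℝ, ENNReal.ofReal (exp (-τ / 2)) *
        ENNReal.ofReal (exp (κ / 2 * ∑ i, x i ^ 2)) ∂Measure.pi (fun _ => gaussianReal 0 1) := by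
        refine lintegral_congr fun x => ?_
        rw [← ENNReal.ofReal_mul (exp_pos _).le, ← exp_add, EuclideanSpace.real_norm_sq_eq]
        congr 2
        rw [hκdef]
        field_simp
        ring
    _ = ENNReal.ofReal (exp (-τ / 2)) * ENNReal.ofReal σ ^ k := by
        rw [lintegral_const_mul _ (by fun_prop), lintegral_pi_exp_sum_sq hσ hκ]
    _ ≤ _ := by
        rw [← ENNReal.ofReal_pow hσ.le, ← ENNReal.ofReal_mul (exp_pos _).le]
        refine ENNReal.ofReal_le_ofReal ?_
        calc exp (-τ / 2) * σ ^ k ≤ exp (-τ / 2) * σ ^ d := by gcongr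
          _ ≤ exp (-τ / 2) * exp (κ / 2 + κ ^ 2) ^ d := by gcongr
          _ = _ := by
              rw [← exp_nat_mul, ← exp_add, hκdef]
              congr 1
              field_simp
              ring

/-! ### The exponent of the recursion -/

/-- Constants for which the column estimate applies to at most `N` vectors at scale `√d`. -/
structure IsPeelData (p c m σ κ T B : ℝ) (N d : ℕ) : Prop where
  p_pos : 0 < p
  c_nonneg : 0 ≤ c
  m_nonneg : 0 ≤ m
  one_le : 1 ≤ σ
  var_eq : σ ^ 2 * (1 - κ) = 1
  d_pos : 0 < d
  le_T : m / (σ * √d) * (3 / 2) ≤ T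
  le_B : m * σ * N * T ≤ B
  le_κ : N * (2 * σ ^ 2 * T ^ 2 * N) ≤ κ
  tail : ∀ y, cdf (gaussianReal 0 1) (-c - y) ≤ p * exp (-(m * y))

/-- A bounded lower approximation of `√d / x`, where `s = x ^ 2`, that is affine in `s` around
`s = d`. -/
noncomputable def radialWeight (d : ℕ) (s : ℝ) : ℝ :=
  max 0 (min (3 / 2) (1 - (s / d - 1) / 2))

theorem radialWeight_nonneg (d : ℕ) (s : ℝ) : 0 ≤ radialWeight d s := le_max_left _ _

theorem radialWeight_le (d : ℕ) (s : ℝ) : radialWeight d s ≤ 3 / 2 :=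
  max_le (by norm_num) (min_le_left _ _)

theorem one_sub_radialWeight_le (d : ℕ) {s : ℝ} (hs : 0 ≤ s) :
    1 - radialWeight d s ≤ (s / d - 1) / 2 := by
  have h : 0 ≤ s / d := by positivity
  have : 1 - (s / d - 1) / 2 ≤ radialWeight d s :=
    le_max_of_le_right (le_min (by linarith) le_rfl)
  linarith

/-- With l = x/√d the nontrivial case is l(3 - l²)/2 ≤ 1, that is (l - 1)²(l + 2) ≥ 0. This allows
√d/‖x‖ to be replaced in the thresholds by a bounded weight. -/
theorem mul_radialWeight_le {d : ℕ} (hd : 0 < d) {x : ℝ} (hx : 0 ≤ x) :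
    x * radialWeight d (x ^ 2) ≤ √d := by
  have hd' : (0 : ℝ) < d := by exact_mod_cast hd
  have hr : 0 < √(d : ℝ) := sqrt_pos.2 hd'
  rw [radialWeight, mul_max_of_nonneg _ _ hx, mul_zero]
  refine max_le hr.le ((mul_le_mul_of_nonneg_left (min_le_right _ _) hx).trans ?_)
  set l := x / √d with hl
  have hxl : x = l * √d := by rw [hl]; field_simp
  have hl0 : 0 ≤ l := by positivity
  have hsq : x ^ 2 / d = l ^ 2 := by rw [hxl, mul_pow, sq_sqrt hd'.le]; field_simp
  rw [hsq, hxl]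
  have : l * (1 - (l ^ 2 - 1) / 2) ≤ 1 := by
    nlinarith [mul_nonneg (sq_nonneg (l - 1)) (by linarith : 0 ≤ l + 2)]
  nlinarith [mul_le_mul_of_nonneg_right this hr.le]

@[fun_prop]
theorem continuous_radialWeight (d : ℕ) : Continuous (radialWeight d) := by
  unfold radialWeight
  fun_prop

/-- The exponent of the bound for the probability that all inner products are small. -/
noncomputable def peelExponent (p c m σ B : ℝ) (d n : ℕ) (w : Fin n → ℝ) (S : Fin n → Fin n → ℝ) :
    ℝ :=
  (n : ℝ) * (n - 1) / 2 * (log p + log σ + σ ^ 2 * B ^ 2 + 3 / 2 * (m * c) * (1 - 1 / σ)) +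
    ∑ j : Fin n, ((n : ℝ) - 1 - j) * (m * c * (1 - w j)) -
    m ^ 3 / √d * ∑ j : Fin n, (j : ℝ) * ((n : ℝ) - 1 - j) * w j -
    m / σ * ∑ j, ∑ i, if j < i then w j * S j i else 0

theorem measurable_exp_peelExponent (p c m σ B : ℝ) (d n : ℕ) (S : Fin n → Fin n → ℝ) :
    Measurable fun s : Fin n → ℝ => ENNReal.ofReal
      (exp (peelExponent p c m σ B d n (fun j => radialWeight d (s j)) S)) := by
  have h : Continuous fun s : Fin n → ℝ =>
      peelExponent p c m σ B d n (fun j => radialWeight d (s j)) S := by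
    unfold peelExponent
    refine .sub (by fun_prop) (.mul continuous_const ?_)
    refine continuous_finsetSum _ fun j _ => continuous_finsetSum _ fun i _ => ?_
    split_ifs <;> fun_prop
  exact ENNReal.measurable_ofReal.comp (continuous_exp.comp h).measurable

/-- Because the exponent is affine in the levels, shifting them by gᵢgⱼ/√d produces exactly the
triangular form in `columnWeight`. -/
theorem peelExponent_add (p c m σ B : ℝ) (d n : ℕ) (w : Fin n → ℝ) (S S' : Fin n → Fin n → ℝ) :
    peelExponent p c m σ B d n w (fun i j => S i j + S' i j) = peelExponent p c m σ B d n w S -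
      m / σ * ∑ j, ∑ i, if j < i then w j * S' j i else 0 := by
  have : ∀ j i : Fin n, (if j < i then w j * (S j i + S' j i) else 0) =
      (if j < i then w j * S j i else 0) + if j < i then w j * S' j i else 0 := by
    intro j i
    split_ifs <;> ring
  simp only [peelExponent, this, Finset.sum_add_distrib]
  ring

/-- Bookkeeping of one peeling step: the column adds n pairs to n(n - 1)/2, and its gain supplies
the missing 1 when the coefficient j becomes j + 1 under reindexing. -/
theorem peelExponent_succ_ge {p c m σ κ T B : ℝ} {N d : ℕ} (h : IsPeelData p c m σ κ T B N d)
    {n : ℕ} (w : Fin (n + 1) → ℝ) (hw : ∀ j, 0 ≤ w j ∧ w j ≤ 3 / 2)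
    (S : Fin (n + 1) → Fin (n + 1) → ℝ) :
    peelExponent p c m σ B d n (fun j => w j.succ) (fun i j => S i.succ j.succ) +
      (∑ i : Fin n, (log p + log σ + σ ^ 2 * B ^ 2 + m * (c - (c + S 0 i.succ) * w 0 / σ)) -
        m ^ 2 * σ ^ 2 * ∑ j : Fin n, ((n : ℝ) - 1 - j) * (m / (σ * √d) * w j.succ)) ≤
    peelExponent p c m σ B d (n + 1) w S := by
  have hσ0 : 0 < σ := zero_lt_one.trans_le h.one_le
  have hr : 0 < √(d : ℝ) := sqrt_pos.2 (by exact_mod_cast h.d_pos)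
  have hm := h.m_nonneg
  have hc := h.c_nonneg
  have hσ1 : 0 ≤ 1 - 1 / σ := by
    rw [sub_nonneg, div_le_one hσ0]; exact h.one_le
  have hS : ∑ i : Fin n, (log p + log σ + σ ^ 2 * B ^ 2 + m * (c - (c + S 0 i.succ) * w 0 / σ)) =
      n * (log p + log σ + σ ^ 2 * B ^ 2 + m * c * (1 - w 0 / σ)) -
        m / σ * ∑ i : Fin n, w 0 * S 0 i.succ := by
    have (i : Fin n) : log p + log σ + σ ^ 2 * B ^ 2 + m * (c - (c + S 0 i.succ) * w 0 / σ) =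
        (log p + log σ + σ ^ 2 * B ^ 2 + m * c * (1 - w 0 / σ)) -
          m / σ * (w 0 * S 0 i.succ) := by ring
    simp_rw [this]
    rw [Finset.sum_sub_distrib, ← Finset.mul_sum, Finset.sum_const, Finset.card_univ,
      Fintype.card_fin, nsmul_eq_mul]
  have hw0 : m * c * (1 - w 0 / σ) ≤ m * c * (1 - w 0) + 3 / 2 * (m * c) * (1 - 1 / σ) := by
    have : m * c * (1 - w 0 / σ) = m * c * (1 - w 0) + m * c * ((1 - 1 / σ) * w 0) := by
      field_simp; ring
    rw [this]
    nlinarith [mul_le_mul_of_nonneg_left (hw 0).2 hσ1,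
      mul_le_mul_of_nonneg_left (mul_le_mul_of_nonneg_left (hw 0).2 hσ1) (mul_nonneg hm hc)]
  have hsum : m ^ 3 / √d * ∑ j : Fin n, ((n : ℝ) - 1 - j) * w j.succ ≤
      m ^ 2 * σ ^ 2 * ∑ j : Fin n, ((n : ℝ) - 1 - j) * (m / (σ * √d) * w j.succ) := by
    rw [Finset.mul_sum, Finset.mul_sum]
    refine Finset.sum_le_sum fun j _ => ?_
    have hj : 0 ≤ (n : ℝ) - 1 - j := by
      have : ((j : ℕ) : ℝ) + 1 ≤ n := by exact_mod_cast j.2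
      linarith
    have : m ^ 2 * σ ^ 2 * (((n : ℝ) - 1 - j) * (m / (σ * √d) * w j.succ)) =
        σ * (m ^ 3 / √d * (((n : ℝ) - 1 - j) * w j.succ)) := by
      field_simp
    rw [this]
    -- The gain carries a surplus factor σ ≥ 1, which is discarded.
    exact le_mul_of_one_le_left (mul_nonneg (by positivity) (mul_nonneg hj (hw _).1)) h.one_le
  have hn : (0 : ℝ) ≤ n := n.cast_nonneg
  rw [hS]
  simp only [peelExponent, Fin.sum_univ_succ, Fin.succ_lt_succ_iff, Fin.succ_pos, Fin.not_lt_zero,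
    if_true, if_false, zero_add, Fin.val_zero, Fin.val_succ, zero_mul,
    Nat.cast_zero, Nat.cast_add, Nat.cast_one]
  have e1 : ∑ j : Fin n, ((n : ℝ) + 1 - 1 - (j + 1)) * (m * c * (1 - w j.succ)) =
      ∑ j : Fin n, ((n : ℝ) - 1 - j) * (m * c * (1 - w j.succ)) :=
    Finset.sum_congr rfl fun j _ => by ring
  have e2 : ∑ j : Fin n, ((j : ℝ) + 1) * ((n : ℝ) + 1 - 1 - (j + 1)) * w j.succ =
      ∑ j : Fin n, (j : ℝ) * ((n : ℝ) - 1 - j) * w j.succ +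
        ∑ j : Fin n, ((n : ℝ) - 1 - j) * w j.succ := by
    rw [← Finset.sum_add_distrib]
    exact Finset.sum_congr rfl fun j _ => by ring
  rw [e1, e2]
  nlinarith [mul_le_mul_of_nonneg_left hw0 hn]

/-- Configurations whose inner products lie below given levels. -/
def lowSet (c : ℝ) (d : ℕ) {n : ℕ} {E : Type*} [NormedAddCommGroup E] [InnerProductSpace ℝ E]
    (S : Fin n → Fin n → ℝ) : Set (Fin n → E) :=
  {y | ∀ i j, i < j → inner ℝ (y i) (y j) < -(√d * (c + S i j))}

theorem cons_mem_lowSet {c : ℝ} {d n : ℕ} {E : Type*} [NormedAddCommGroup E]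
    [InnerProductSpace ℝ E] {S : Fin (n + 1) → Fin (n + 1) → ℝ} {x : E} {y : Fin n → E} :
    (Fin.cons x y : Fin (n + 1) → E) ∈ lowSet c d S ↔
      (∀ i, inner ℝ x (y i) < -(√d * (c + S 0 i.succ))) ∧
        y ∈ lowSet c d fun i j => S i.succ j.succ := by
  simp [lowSet, Fin.forall_fin_succ, Fin.succ_lt_succ_iff]

theorem measurableSet_lowSet (c : ℝ) (d : ℕ) {n : ℕ} {E : Type*} [NormedAddCommGroup E]
    [InnerProductSpace ℝ E] [FiniteDimensional ℝ E] [MeasurableSpace E] [BorelSpace E]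
    (S : Fin n → Fin n → ℝ) : MeasurableSet (lowSet c d S : Set (Fin n → E)) := by
  simp only [lowSet, ofPred_forall]
  exact .iInter fun i => .iInter fun j => .iInter fun _ =>
    measurableSet_lt (by fun_prop) measurable_const

/-! ### Peeling off one vector at a time -/

theorem pi_stdGaussian_eq_map_prod {E : Type*} [NormedAddCommGroup E] [InnerProductSpace ℝ E]
    [FiniteDimensional ℝ E] [MeasurableSpace E] [BorelSpace E] {e : E} (he : ‖e‖ = 1) (n : ℕ) :
    (Measure.pi fun _ : Fin n => stdGaussian E) =
      ((Measure.pi fun _ : Fin n => gaussianReal 0 1).prod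
        (Measure.pi fun _ : Fin n => stdGaussian (Submodule.span ℝ {e})ᗮ)).map
        fun q i => q.1 i • e + (q.2 i : E) := by
  have h := (measurePreserving_arrowProdEquivProdArrow ℝ (Submodule.span ℝ {e})ᗮ (Fin n)
    (fun _ => gaussianReal 0 1) (fun _ => stdGaussian (Submodule.span ℝ {e})ᗮ)).symm
  have hf : Measurable fun q : ℝ × (Submodule.span ℝ {e})ᗮ => q.1 • e + (q.2 : E) := by fun_prop
  have : ∀ _ : Fin n, SigmaFinite (((gaussianReal 0 1).prod
      (stdGaussian (Submodule.span ℝ {e})ᗮ)).map fun q => q.1 • e + (q.2 : E)) := fun _ => by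
    rw [stdGaussian_eq_map_prod he]; infer_instance
  have h2 := Measure.pi_map_pi (μ := fun _ : Fin n => (gaussianReal 0 1).prod
    (stdGaussian (Submodule.span ℝ {e})ᗮ)) (f := fun _ q => q.1 • e + (q.2 : E))
    fun _ => hf.aemeasurable
  rw [stdGaussian_eq_map_prod he] at h2
  rw [← h2, ← h.map_eq, Measure.map_map (by fun_prop) (MeasurableEquiv.measurable _)]
  rfl

/-- The bound for the probability of `lowSet` in terms of independent chi-squared variables. -/
def PeelBound (p c m σ B : ℝ) (d n : ℕ) : Prop :=
  ∀ (E : Type) [NormedAddCommGroup E] [InnerProductSpace ℝ E] [FiniteDimensional ℝ E]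
    [MeasurableSpace E] [BorelSpace E] (S : Fin n → Fin n → ℝ), (∀ i j, 0 ≤ S i j) →
    (Measure.pi fun _ : Fin n => stdGaussian E) (lowSet c d S) ≤
      ∫⁻ s, ENNReal.ofReal (exp (peelExponent p c m σ B d n (fun j => radialWeight d (s j)) S))
        ∂Measure.pi fun j : Fin n => chiSq (Module.finrank ℝ E - j)

theorem inner_smul_add_orthogonal {E : Type*} [NormedAddCommGroup E] [InnerProductSpace ℝ E]
    {e : E} (he : ‖e‖ = 1) (a b : ℝ) (z z' : (Submodule.span ℝ {e})ᗮ) :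
    inner ℝ (a • e + (z : E)) (b • e + (z' : E)) = a * b + inner ℝ z z' := by
  have h1 : inner ℝ e (z : E) = 0 := Submodule.mem_orthogonal_singleton_iff_inner_right.1 z.2
  have h2 : inner ℝ e (z' : E) = 0 := Submodule.mem_orthogonal_singleton_iff_inner_right.1 z'.2
  rw [inner_add_left, inner_add_right, inner_add_right, real_inner_smul_left,
    real_inner_smul_right, real_inner_smul_left, real_inner_smul_right, real_inner_comm e (z : E),
    h1, h2, real_inner_self_eq_norm_sq, he]
  simp

theorem inner_smul_unit_add_orthogonal {E : Type*} [NormedAddCommGroup E] [InnerProductSpace ℝ E]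
    {e : E} (he : ‖e‖ = 1) (a b : ℝ) (z : (Submodule.span ℝ {e})ᗮ) :
    inner ℝ (a • e) (b • e + (z : E)) = a * b := by
  simpa using inner_smul_add_orthogonal he a b 0 z

theorem lintegral_peel_column_le {p c m σ κ T B : ℝ} {N d : ℕ} (h : IsPeelData p c m σ κ T B N d)
    {n : ℕ} (hn : n ≤ N) (w : Fin (n + 1) → ℝ) (hw : ∀ j, 0 ≤ w j ∧ w j ≤ 3 / 2)
    (S : Fin (n + 1) → Fin (n + 1) → ℝ) :
    ∫⁻ g, ENNReal.ofReal (exp (peelExponent p c m σ B d n (fun j => w j.succ)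
        (fun i j => S i.succ j.succ))) *
      columnWeight (fun j => m / (σ * √d) * w j.succ) (fun i => (c + S 0 i.succ) * w 0) 0 0 g
      ∂Measure.pi (fun _ => gaussianReal 0 1) ≤
    ENNReal.ofReal (exp (peelExponent p c m σ B d (n + 1) w S)) := by
  have hσ0 : 0 < σ := zero_lt_one.trans_le h.one_le
  have hr : 0 < √(d : ℝ) := sqrt_pos.2 (by exact_mod_cast h.d_pos)
  have hm := h.m_nonneg
  have hq : 0 ≤ m / (σ * √d) := by positivity
  have hT : 0 ≤ T := le_trans (by positivity) h.le_T
  have hnN : (n : ℝ) ≤ N := by exact_mod_cast hn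
  rw [lintegral_const_mul _ (measurable_columnWeight _ _ _ _)]
  have hcol := lintegral_columnWeight_le (c := c) h.p_pos hm hσ0 h.var_eq hT h.tail n hn
    (fun j => m / (σ * √d) * w j.succ) (fun i => (c + S 0 i.succ) * w 0)
    (fun j => ⟨mul_nonneg hq (hw _).1,
      (mul_le_mul_of_nonneg_left (hw _).2 hq).trans h.le_T⟩) 0 0 le_rfl
    (by
      refine le_trans ?_ h.le_B
      rw [zero_add]
      gcongr)
    (by
      refine le_trans ?_ h.le_κ
      rw [zero_add]
      gcongr)
  refine (mul_le_mul_right hcol _).trans ?_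
  rw [← ENNReal.ofReal_mul (exp_pos _).le, ← exp_add]
  refine ENNReal.ofReal_le_ofReal (exp_le_exp.2 ?_)
  rw [mul_zero, sub_zero]
  exact peelExponent_succ_ge h w hw S

theorem measurableSet_setOf_cons_mem {α : Type*} [MeasurableSpace α] {n : ℕ}
    {A : Set (Fin (n + 1) → α)} (hA : MeasurableSet A) (x : α) :
    MeasurableSet {y : Fin n → α | (Fin.cons x y : Fin (n + 1) → α) ∈ A} := by
  have h : Measurable fun y : Fin n → α => (Fin.cons x y : Fin (n + 1) → α) :=
    measurable_fin_cons.comp measurable_prodMk_left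
  exact h hA

/-- With the first vector fixed, condition on the components g of the others along it. The induction
hypothesis applies in the orthogonal complement with raised levels; the shifts gᵢgⱼ/√d are
nonnegative because all admissible gᵢ are nonpositive. Exchanging the integrals over g and over the
later norms leaves the column estimate. -/
theorem measure_slice_le {p c m σ κ T B : ℝ} {N d : ℕ} (h : IsPeelData p c m σ κ T B N d)
    {n : ℕ} (hn : n ≤ N) (ih : PeelBound p c m σ B d n) {E : Type} [NormedAddCommGroup E]
    [InnerProductSpace ℝ E] [FiniteDimensional ℝ E] [MeasurableSpace E] [BorelSpace E]
    (S : Fin (n + 1) → Fin (n + 1) → ℝ) (hS : ∀ i j, 0 ≤ S i j) (x : E) :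
    (Measure.pi fun _ : Fin n => stdGaussian E) {y | (Fin.cons x y : Fin (n + 1) → E) ∈ lowSet c d S} ≤
      ∫⁻ s, ENNReal.ofReal (exp (peelExponent p c m σ B d (n + 1)
        (fun j => radialWeight d ((Fin.cons (‖x‖ ^ 2) s : Fin (n + 1) → ℝ) j)) S))
        ∂Measure.pi fun j : Fin n => chiSq (Module.finrank ℝ E - (j + 1)) := by
  have hc := h.c_nonneg
  have hr : 0 < √(d : ℝ) := sqrt_pos.2 (by exact_mod_cast h.d_pos)
  have hcS (i j) : 0 ≤ c + S i j := add_nonneg hc (hS i j)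
  rcases eq_or_ne x 0 with rfl | hx
  -- A zero vector has no direction to split off. If it is alone, the exponent is 0; otherwise its
  -- inner products vanish and cannot lie below a nonpositive level.
  · rcases Nat.eq_zero_or_pos n with rfl | hnpos
    · simp [peelExponent, prob_le_one]
    · have : {y | (Fin.cons (0 : E) y : Fin (n + 1) → E) ∈ lowSet c d S} = ∅ := by
        refine eq_empty_of_forall_notMem fun y hy => ?_
        have := (cons_mem_lowSet.1 hy).1 ⟨0, hnpos⟩
        rw [inner_zero_left] at this
        have := mul_nonneg hr.le (hcS 0 (Fin.succ ⟨0, hnpos⟩))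
        linarith
      rw [this, measure_empty]
      exact zero_le
  have hx0 : 0 < ‖x‖ := norm_pos_iff.2 hx
  set e : E := ‖x‖⁻¹ • x with he_def
  have he : ‖e‖ = 1 := by rw [he_def, norm_smul, norm_inv, norm_norm, inv_mul_cancel₀ hx0.ne']
  have hxe : x = ‖x‖ • e := by rw [he_def, smul_smul, mul_inv_cancel₀ hx0.ne', one_smul]
  set W := (Submodule.span ℝ {e})ᗮ with hW
  have hrank : Module.finrank ℝ W = Module.finrank ℝ E - 1 := finrank_orthogonal_span_unit he
  set w0 := radialWeight d (‖x‖ ^ 2) with hw0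
  set u : Fin n → ℝ := fun i => (c + S 0 i.succ) * w0 with hu
  set μ := Measure.pi fun j : Fin n => chiSq (Module.finrank ℝ E - (j + 1)) with hμ
  have hslice (g : Fin n → ℝ) :
      (Measure.pi fun _ : Fin n => stdGaussian W)
        {z | (Fin.cons x (fun i => g i • e + (z i : E)) : Fin (n + 1) → E) ∈ lowSet c d S} ≤
      ∫⁻ s, ENNReal.ofReal (exp (peelExponent p c m σ B d n (fun j => radialWeight d (s j))
          (fun i j => S i.succ j.succ))) *
        columnWeight (fun j => m / (σ * √d) * radialWeight d (s j)) u 0 0 g ∂μ := by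
    by_cases hg : ∀ i, g i < -u i
    · have hg0 (i) : g i ≤ 0 := by
        have : 0 ≤ u i := mul_nonneg (hcS _ _) (radialWeight_nonneg _ _)
        linarith [hg i]
      refine le_trans (measure_mono (fun z hz => ?_)) ((ih W
        (fun i j => S i.succ j.succ + g i * g j / √d)
        (fun i j => add_nonneg (hS _ _)
          (div_nonneg (mul_nonneg_of_nonpos_of_nonpos (hg0 i) (hg0 j)) hr.le))).trans_eq ?_)
      · intro i j hij
        have := (cons_mem_lowSet.1 hz).2 i j hij
        rw [inner_smul_add_orthogonal he] at this
        have e1 : √d * (c + (S i.succ j.succ + g i * g j / √d)) =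
            √d * (c + S i.succ j.succ) + g i * g j := by field_simp; ring
        rw [e1]
        linarith
      · have hmeas : (fun j : Fin n => chiSq (Module.finrank ℝ W - j)) =
            fun j : Fin n => chiSq (Module.finrank ℝ E - (j + 1)) := by
          ext1 j
          rw [hrank, Nat.sub_sub, Nat.add_comm 1]
        rw [hμ, ← hmeas]
        refine lintegral_congr fun s => ?_
        rw [columnWeight, if_pos hg, ← ENNReal.ofReal_mul (exp_pos _).le, ← exp_add]
        congr 2
        rw [peelExponent_add]
        simp only [zero_mul, zero_div, add_zero]
        rw [sub_eq_add_neg, Finset.mul_sum]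
        congr 2
        refine Finset.sum_congr rfl fun j _ => ?_
        rw [Finset.mul_sum]
        refine Finset.sum_congr rfl fun i _ => ?_
        split_ifs
        · ring
        · ring
    · have : {z : Fin n → W |
          (Fin.cons x (fun i => g i • e + (z i : E)) : Fin (n + 1) → E) ∈ lowSet c d S} = ∅ := by
        refine eq_empty_of_forall_notMem fun z hz => hg fun i => ?_
        have h1 := (cons_mem_lowSet.1 hz).1 i
        rw [hxe, inner_smul_unit_add_orthogonal he] at h1
        have h2 := mul_le_mul_of_nonneg_left (mul_radialWeight_le h.d_pos hx0.le) (hcS 0 i.succ)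
        refine lt_of_mul_lt_mul_left ?_ hx0.le
        rw [hu]
        linarith
      rw [this, measure_empty]
      exact zero_le
  have hmeasSet : MeasurableSet {y | (Fin.cons x y : Fin (n + 1) → E) ∈ lowSet c d S} :=
    measurableSet_setOf_cons_mem (measurableSet_lowSet c d S) x
  rw [pi_stdGaussian_eq_map_prod he, Measure.map_apply (by fun_prop) hmeasSet,
    Measure.prod_apply (by exact (by fun_prop : Measurable
      fun (q : (Fin n → ℝ) × (Fin n → W)) i => q.1 i • e + (q.2 i : E)) hmeasSet)]
  refine (lintegral_mono hslice).trans ?_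
  rw [lintegral_lintegral_swap]
  · refine lintegral_mono fun s => ?_
    have := lintegral_peel_column_le h hn
      (fun j => radialWeight d ((Fin.cons (‖x‖ ^ 2) s : Fin (n + 1) → ℝ) j))
      (fun j => ⟨radialWeight_nonneg _ _, radialWeight_le _ _⟩) S
    simpa only [Fin.cons_zero, Fin.cons_succ] using this
  · refine Measurable.aemeasurable (.mul ?_ ?_)
    · exact (measurable_exp_peelExponent p c m σ B d n _).comp measurable_snd
    · have ht : Continuous fun (q : (Fin n → ℝ) × (Fin n → ℝ)) j =>
          m / (σ * √d) * radialWeight d (q.2 j) := by fun_prop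
      exact (measurable_columnWeight_prod u 0 0).comp (ht.measurable.prodMk measurable_fst)

theorem peelBound {p c m σ κ T B : ℝ} {N d : ℕ} (h : IsPeelData p c m σ κ T B N d) :
    ∀ n ≤ N, PeelBound p c m σ B d n := by
  intro n
  induction n with
  | zero =>
    intro _ E _ _ _ _ _ S _
    simp [peelExponent, prob_le_one]
  | succ n ih =>
    intro hn E _ _ _ _ _ S hS
    have ih' := ih ((Nat.le_succ n).trans hn)
    have hF := measurable_exp_peelExponent p c m σ B d (n + 1) S
    have hset := measurableSet_lowSet (E := E) c d S
    rw [← lintegral_indicator_one hset, lintegral_pi_succ _ (measurable_one.indicator hset),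
      lintegral_pi_succ _ hF]
    simp only [Fin.val_zero, Nat.sub_zero, Fin.val_succ]
    rw [← map_norm_sq_stdGaussian (E := E), lintegral_map _ (by fun_prop)]
    · refine lintegral_mono fun x => ?_
      have hm : MeasurableSet {y | (Fin.cons x y : Fin (n + 1) → E) ∈ lowSet c d S} :=
        measurableSet_setOf_cons_mem hset x
      refine le_trans (le_of_eq ?_) (measure_slice_le h ((Nat.le_succ n).trans hn) ih' S hS x)
      rw [← lintegral_indicator_one hm]
      rfl
    · exact (hF.comp measurable_fin_cons).lintegral_prod_right'

/-! ### The probability of a red clique -/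

theorem lintegral_pi_prod_eq {α : Type*} [MeasurableSpace α] {n : ℕ} (μ : Fin n → Measure α)
    [∀ i, IsProbabilityMeasure (μ i)] (f : Fin n → α → ENNReal) (hf : ∀ i, Measurable (f i)) :
    ∫⁻ x, ∏ i, f i (x i) ∂Measure.pi μ = ∏ i, ∫⁻ x, f i x ∂μ i := by
  induction n with
  | zero => simp
  | succ n ih =>
    have hprod : Measurable fun x : Fin (n + 1) → α => ∏ i, f i (x i) :=
      Finset.measurable_prod _ fun i _ => (hf i).comp (measurable_pi_apply i)
    rw [lintegral_pi_succ _ hprod]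
    simp_rw [Fin.prod_univ_succ, Fin.cons_zero, Fin.cons_succ]
    have hprod' : Measurable fun x : Fin n → α => ∏ i, f i.succ (x i) :=
      Finset.measurable_prod _ fun i _ => (hf i.succ).comp (measurable_pi_apply i)
    simp_rw [lintegral_const_mul _ hprod']
    rw [lintegral_mul_const _ (hf 0), ih (fun i => μ i.succ) (fun i => f i.succ) fun i => hf _]

/-- Triples are counted by their middle element. -/
theorem sum_mul_rev_eq_choose (n : ℕ) :
    ∑ j : Fin n, (j : ℝ) * ((n : ℝ) - 1 - j) = (n.choose 3 : ℝ) := by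
  rw [Fin.sum_univ_eq_sum_range (fun j : ℕ => (j : ℝ) * ((n : ℝ) - 1 - j))]
  induction n with
  | zero => simp
  | succ n ih =>
    have h2 : ∑ j ∈ Finset.range n, (j : ℝ) = (n.choose 2 : ℝ) := by
      rw [Nat.choose_two_right, ← Finset.sum_range_id, Nat.cast_sum]
    rw [Finset.sum_range_succ, Nat.choose_succ_succ' n 2]
    push_cast
    rw [← ih, ← h2, ← Finset.sum_add_distrib]
    simp only [add_sub_cancel_right, sub_self, mul_zero, add_zero]
    exact Finset.sum_congr rfl fun j _ => by ring

theorem lintegral_chiSq_radialWeight_le {k d : ℕ} (hkd : k ≤ d) (hd : 0 < d) {τ : ℝ} (h0 : 0 ≤ τ)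
    (hτ : τ ≤ d / 2) :
    ∫⁻ s, ENNReal.ofReal (exp (τ * (1 - radialWeight d s))) ∂chiSq k ≤
      ENNReal.ofReal (exp (τ ^ 2 / d)) := by
  refine le_trans (lintegral_mono_ae ?_) (lintegral_chiSq_exp_le hkd hd h0 hτ)
  have hs : ∀ᵐ s ∂chiSq k, 0 ≤ s := by
    rw [chiSq, ae_map_iff (by fun_prop) measurableSet_Ici]
    exact .of_forall fun y => sq_nonneg _
  filter_upwards [hs] with s hs
  exact ENNReal.ofReal_le_ofReal (exp_le_exp.2
    (mul_le_mul_of_nonneg_left (one_sub_radialWeight_le d hs) h0))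

/-- Writing w = 1 - (1 - w) splits the exponent into its value at w = 1 and a sum of single-norm
terms tⱼ(1 - wⱼ). Independence factors the integral, and each factor costs at most exp(τ²/d), with τ
a common bound for the tⱼ. -/
theorem lintegral_peelExponent_le {p c m σ B τ : ℝ} {n d : ℕ} (hd : 0 < d) (hc : 0 ≤ c)
    (hm : 0 ≤ m) (hτ : n * (m * c) + m ^ 3 / √d * n ^ 2 ≤ τ) (hτd : τ ≤ d / 2) (k : Fin n → ℕ)
    (hk : ∀ j, k j ≤ d) :
    ∫⁻ s, ENNReal.ofReal (exp (peelExponent p c m σ B d n (fun j => radialWeight d (s j))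
        fun _ _ => 0)) ∂Measure.pi (fun j => chiSq (k j)) ≤
      ENNReal.ofReal (exp ((n : ℝ) * (n - 1) / 2 *
        (log p + log σ + σ ^ 2 * B ^ 2 + 3 / 2 * (m * c) * (1 - 1 / σ)) -
        m ^ 3 / √d * n.choose 3 + n * (τ ^ 2 / d))) := by
  set A : ℝ := (n : ℝ) * (n - 1) / 2 *
    (log p + log σ + σ ^ 2 * B ^ 2 + 3 / 2 * (m * c) * (1 - 1 / σ)) - m ^ 3 / √d * n.choose 3
  set q : ℝ := m ^ 3 / √d
  have hq : 0 ≤ q := by positivity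
  set t : Fin n → ℝ := fun j => ((n : ℝ) - 1 - j) * (m * c) + q * (j * ((n : ℝ) - 1 - j))
  have hj (j : Fin n) : 0 ≤ (n : ℝ) - 1 - j := by
    have : ((j : ℕ) : ℝ) + 1 ≤ n := by exact_mod_cast j.2
    linarith
  have hmc : 0 ≤ m * c := mul_nonneg hm hc
  have ht0 (j) : 0 ≤ t j := add_nonneg (mul_nonneg (hj j) hmc)
    (mul_nonneg hq (mul_nonneg (Nat.cast_nonneg _) (hj j)))
  have htτ (j) : t j ≤ τ := by
    refine le_trans (add_le_add (mul_le_mul_of_nonneg_right ?_ hmc)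
      (mul_le_mul_of_nonneg_left ?_ hq)) hτ
    · have : (0 : ℝ) ≤ (j : ℕ) := Nat.cast_nonneg _
      linarith
    · have h1 : (0 : ℝ) ≤ (j : ℕ) := Nat.cast_nonneg _
      have := hj j
      rw [sq]
      exact mul_le_mul (by linarith) (by linarith) this (Nat.cast_nonneg _)
  have hsplit (s : Fin n → ℝ) : ENNReal.ofReal (exp (peelExponent p c m σ B d n
      (fun j => radialWeight d (s j)) fun _ _ => 0)) = ENNReal.ofReal (exp A) *
        ∏ j, ENNReal.ofReal (exp (t j * (1 - radialWeight d (s j)))) := by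
    rw [← ENNReal.ofReal_prod_of_nonneg fun _ _ => (exp_pos _).le, ← exp_sum,
      ← ENNReal.ofReal_mul (exp_pos _).le, ← exp_add]
    congr 2
    have h1 : ∑ j, t j * (1 - radialWeight d (s j)) =
        ∑ j : Fin n, ((n : ℝ) - 1 - j) * (m * c * (1 - radialWeight d (s j))) +
        (q * ∑ j : Fin n, (j : ℝ) * ((n : ℝ) - 1 - j) -
          q * ∑ j : Fin n, (j : ℝ) * ((n : ℝ) - 1 - j) * radialWeight d (s j)) := by
      rw [Finset.mul_sum, Finset.mul_sum, ← Finset.sum_sub_distrib, ← Finset.sum_add_distrib]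
      exact Finset.sum_congr rfl fun j _ => by ring
    rw [h1, sum_mul_rev_eq_choose]
    simp only [peelExponent, mul_zero, ite_self, Finset.sum_const_zero, A]
    ring
  simp_rw [hsplit]
  rw [lintegral_const_mul _ (by fun_prop), lintegral_pi_prod_eq _
    (fun j s => ENNReal.ofReal (exp (t j * (1 - radialWeight d s)))) (fun j => by fun_prop),
    exp_add A, ENNReal.ofReal_mul (exp_pos _).le]
  refine mul_le_mul_right ?_ _
  calc _ ≤ ∏ _j : Fin n, ENNReal.ofReal (exp (τ ^ 2 / d)) := by
        refine Finset.prod_le_prod' fun j _ => ?_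
        refine (lintegral_chiSq_radialWeight_le (hk j) hd (ht0 j) ((htτ j).trans hτd)).trans ?_
        refine ENNReal.ofReal_le_ofReal (exp_le_exp.2 ?_)
        have := pow_le_pow_left₀ (ht0 j) (htτ j) 2
        gcongr
    _ = _ := by
        rw [Finset.prod_const, Finset.card_univ, Fintype.card_fin,
          ← ENNReal.ofReal_pow (exp_pos _).le, ← exp_nat_mul]

/-! ### Rescaling to standard Gaussian vectors and fixing the parameters -/

theorem multivariateGaussian_inv_smul_one {d : ℕ} (hd : 0 < d) :
    multivariateGaussian 0 ((d : ℝ)⁻¹ • (1 : Matrix (Fin d) (Fin d) ℝ)) =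
      (stdGaussian (EuclideanSpace ℝ (Fin d))).map fun y => (√(d : ℝ))⁻¹ • y := by
  have hS : ((d : ℝ)⁻¹ • (1 : Matrix (Fin d) (Fin d) ℝ)).PosSemidef :=
    Matrix.PosSemidef.one.smul (by positivity)
  apply Measure.ext_of_charFun
  ext t
  rw [charFun_multivariateGaussian hS, charFun_map_smul, charFun_stdGaussian]
  congr 1
  have h1 : ‖(√(d : ℝ))⁻¹ • t‖ ^ 2 = (d : ℝ)⁻¹ * ∑ i, t i ^ 2 := by
    rw [norm_smul, mul_pow, norm_inv, inv_pow, norm_of_nonneg (sqrt_nonneg _),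
      sq_sqrt (Nat.cast_nonneg _), EuclideanSpace.real_norm_sq_eq]
  have h2 : t.ofLp ⬝ᵥ ((d : ℝ)⁻¹ • (1 : Matrix (Fin d) (Fin d) ℝ)).mulVec t.ofLp =
      (d : ℝ)⁻¹ * ∑ i, t i ^ 2 := by
    rw [Matrix.smul_mulVec, Matrix.one_mulVec, dotProduct_smul, smul_eq_mul]
    simp only [dotProduct, sq]
  rw [← Complex.ofReal_pow, h1, h2, inner_zero_right]
  simp [neg_div]

theorem probRed_le_lowSet (p : ℝ) (r : ℕ) {d : ℕ} (hd : 0 < d) :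
    ENNReal.ofReal (probRed p r d) ≤
      (Measure.pi fun _ : Fin r => stdGaussian (EuclideanSpace ℝ (Fin d)))
        (lowSet (threshold p) d fun _ _ => 0) := by
  have hd' : (0 : ℝ) < d := by exact_mod_cast hd
  have hr : 0 < √(d : ℝ) := sqrt_pos.2 hd'
  set A : Set (Fin r → EuclideanSpace ℝ (Fin d)) :=
    {x | ∀ i j, i < j → inner ℝ (x i) (x j) < -threshold p / √d} with hA
  have hAm : MeasurableSet A := by
    simp only [hA, ofPred_forall]
    exact .iInter fun i => .iInter fun j => .iInter fun _ =>
      measurableSet_lt (by fun_prop) measurable_const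
  have hsub : {x : Fin r → EuclideanSpace ℝ (Fin d) | IsRedClique p x} ⊆ A := by
    intro x hx i j hij
    by_contra hcon
    exact hx (mem_univ i) (mem_univ j) hij.ne ⟨hij.ne, not_lt.1 hcon⟩
  have hlaw : sampleLaw r d = (Measure.pi fun _ : Fin r => stdGaussian (EuclideanSpace ℝ (Fin d))).map
      fun y i => (√(d : ℝ))⁻¹ • y i := by
    have : IsProbabilityMeasure ((stdGaussian (EuclideanSpace ℝ (Fin d))).map
        fun y => (√(d : ℝ))⁻¹ • y) := Measure.isProbabilityMeasure_map (by fun_prop)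
    rw [Measure.pi_map_pi (μ := fun _ : Fin r => stdGaussian (EuclideanSpace ℝ (Fin d)))
      (f := fun _ y => (√(d : ℝ))⁻¹ • y) fun _ => by fun_prop, sampleLaw,
      multivariateGaussian_inv_smul_one hd]
  have : IsProbabilityMeasure (sampleLaw r d) := by
    rw [hlaw]; exact Measure.isProbabilityMeasure_map (Measurable.aemeasurable (by fun_prop))
  rw [probRed, ofReal_measureReal]
  refine (measure_mono hsub).trans ?_
  rw [hlaw, Measure.map_apply (by fun_prop) hAm]
  refine measure_mono fun y hy i j hij => ?_
  have h := hy i j hij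
  rw [real_inner_smul_left, real_inner_smul_right, lt_div_iff₀ hr] at h
  have e : (√(d : ℝ))⁻¹ * ((√(d : ℝ))⁻¹ * inner ℝ (y i) (y j)) * √d =
      (√(d : ℝ))⁻¹ * inner ℝ (y i) (y j) := by field_simp
  rw [e, inv_mul_lt_iff₀ hr] at h
  simpa using h

theorem probRedPerfect_le_probRed (C p : ℝ) (ℓ r d : ℕ) :
    probRedPerfect C p ℓ r d ≤ probRed p r d := by
  have : IsProbabilityMeasure (sampleLaw r d) := by unfold sampleLaw; infer_instance
  exact measureReal_mono fun x hx => hx.1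

theorem log_inv_sqrt_le {κ : ℝ} (h1 : κ ≤ 1 / 2) (h0 : 0 ≤ κ) : log (√(1 - κ))⁻¹ ≤ κ := by
  have hpos : 0 < 1 - κ := by linarith
  have h := one_sub_inv_le_log_of_pos hpos
  have h2 : (1 - κ)⁻¹ ≤ 1 + 2 * κ := by
    rw [inv_le_iff_one_le_mul₀ hpos]
    nlinarith
  rw [log_inv, log_sqrt hpos.le]
  linarith

theorem cast_choose_two_bounds (r : ℕ) :
    0 ≤ (r : ℝ) * (r - 1) / 2 ∧ (r : ℝ) * (r - 1) / 2 ≤ r ^ 2 / 2 := by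
  rw [← Nat.cast_choose_two]
  refine ⟨Nat.cast_nonneg _, ?_⟩
  have : (0 : ℝ) ≤ r := Nat.cast_nonneg r
  rw [Nat.cast_choose_two]
  linarith

/-- The bound for the probability of a red clique, with an error of order `r ^ 4 / d + r ^ 3 / d`. -/
theorem probRed_le {p : ℝ} (hp : p ∈ Ioo (0 : ℝ) (1 / 2)) {m c : ℝ} (hm : m = aConst p / p)
    (hc : c = threshold p) {r d : ℕ} (hd : 0 < d) (hr : 36 * m ^ 2 * r ^ 2 ≤ d)
    (hτ : 2 * (r * (m * c) + m ^ 3 / √d * r ^ 2) ≤ d) :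
    probRed p r d ≤ p ^ (r.choose 2) * exp (-(m ^ 3 / √d * r.choose 3) +
      (9 * m ^ 2 + 18 * m ^ 4 + 27 / 2 * m ^ 3 * c) * (r ^ 4 / d) +
        r * ((r * (m * c) + m ^ 3 / √d * r ^ 2) ^ 2 / d)) := by
  have hm0 : 0 < m := hm ▸ div_pos (aConst_pos p) hp.1
  have hc0 : 0 < c := hc ▸ (threshold_spec hp).1
  have hd' : (0 : ℝ) < d := by exact_mod_cast hd
  have hR : 0 < √(d : ℝ) := sqrt_pos.2 hd'
  have hRR : √(d : ℝ) ^ 2 = d := sq_sqrt hd'.le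
  have hr0 : (0 : ℝ) ≤ r := Nat.cast_nonneg r
  set e : ℝ := (r : ℝ) ^ 2 / d with he
  have he0 : 0 ≤ e := by positivity
  -- The recursion needs 2σ²T²r² ≤ κ. With T = 3m/(2√d) and σ² ≤ 2 the left side is at most 9m²e, so
  -- this choice suffices; the hypothesis `hr` says precisely κ ≤ 1/2, which in turn gives σ² ≤ 2.
  set κ : ℝ := 18 * m ^ 2 * e with hκ
  have hκ0 : 0 ≤ κ := by positivity
  have hκ2 : κ ≤ 1 / 2 := by
    rw [hκ, he, ← mul_div_assoc, div_le_iff₀ hd']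
    linarith
  have hpos : 0 < 1 - κ := by linarith
  set σ : ℝ := (√(1 - κ))⁻¹ with hσ
  have hσ0 : 0 < σ := inv_pos.2 (sqrt_pos.2 hpos)
  have hσsq : σ ^ 2 = (1 - κ)⁻¹ := by rw [hσ, inv_pow, sq_sqrt hpos.le]
  have hσ2 : σ ^ 2 ≤ 2 := by
    rw [hσsq, inv_le_iff_one_le_mul₀ hpos]
    linarith
  have hσ1 : 1 ≤ σ := by
    refine (sq_le_sq₀ zero_le_one hσ0.le).1 ?_
    rw [hσsq, one_pow, one_le_inv₀ hpos]
    linarith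
  set T : ℝ := 3 / 2 * m / √d with hT
  have hTsq : T ^ 2 * r ^ 2 = 9 / 4 * m ^ 2 * e := by
    rw [hT, div_pow, hRR, he]; field_simp; ring
  set B : ℝ := m * σ * r * T with hB
  have hBsq : B ^ 2 = m ^ 2 * σ ^ 2 * (9 / 4 * m ^ 2 * e) := by rw [← hTsq, hB]; ring
  have hdata : IsPeelData p c m σ κ T B r d :=
    { p_pos := hp.1
      c_nonneg := hc0.le
      m_nonneg := hm0.le
      one_le := hσ1
      var_eq := by rw [hσsq]; exact inv_mul_cancel₀ hpos.ne'
      d_pos := hd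
      le_T := by
        have : m / (σ * √d) ≤ m / √d :=
          div_le_div_of_nonneg_left hm0.le hR (le_mul_of_one_le_left hR.le hσ1)
        calc _ ≤ m / √d * (3 / 2) := by gcongr
          _ = T := by rw [hT]; ring
      le_B := le_rfl
      le_κ := by
        calc _ = 2 * σ ^ 2 * (T ^ 2 * r ^ 2) := by ring
          _ ≤ 2 * 2 * (T ^ 2 * r ^ 2) := by gcongr
          _ ≤ κ := by
            rw [hTsq, hκ]
            linarith [mul_nonneg (sq_nonneg m) he0]
      tail := fun y => by rw [hm, hc]; exact cdf_tail_le hp y }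
  have hlow := probRed_le_lowSet p r hd
  rw [← hc] at hlow
  have hbound := hlow.trans (peelBound hdata r le_rfl (EuclideanSpace ℝ (Fin d)) (fun _ _ => 0)
    fun _ _ => le_rfl)
  have hint := lintegral_peelExponent_le (p := p) (σ := σ) (B := B) (n := r) hd hc0.le hm0.le
    -- Here `le_rfl` fixes τ as r·mc + (m³/√d)·r².
    le_rfl (by linarith)
    (fun j => Module.finrank ℝ (EuclideanSpace ℝ (Fin d)) - j) fun j => by simp
  have hfin := hbound.trans hint
  rw [ENNReal.ofReal_le_ofReal_iff (exp_pos _).le] at hfin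
  refine hfin.trans ?_
  rw [← exp_log (pow_pos hp.1 _), ← exp_add, exp_le_exp, log_pow, Nat.cast_choose_two]
  have hlogσ : log σ ≤ κ := log_inv_sqrt_le hκ2 hκ0
  have hinv : 1 - 1 / σ ≤ κ := by
    have := one_sub_inv_le_log_of_pos hσ0
    rw [one_div]
    linarith
  have hB2 : σ ^ 2 * B ^ 2 ≤ 36 * m ^ 4 * e := by
    rw [hBsq]
    have h4 : σ ^ 2 * σ ^ 2 ≤ 2 * 2 := mul_le_mul hσ2 hσ2 (sq_nonneg _) (by norm_num)
    have : 0 ≤ m ^ 4 * e := by positivity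
    linarith [mul_le_mul_of_nonneg_right h4 this]
  have hmc : 3 / 2 * (m * c) * (1 - 1 / σ) ≤ 3 / 2 * (m * c) * κ :=
    mul_le_mul_of_nonneg_left hinv (by positivity)
  have hL : log σ + σ ^ 2 * B ^ 2 + 3 / 2 * (m * c) * (1 - 1 / σ) ≤
      (18 * m ^ 2 + 36 * m ^ 4 + 27 * m ^ 3 * c) * e := by
    rw [hκ] at hlogσ hmc
    linarith
  have hrr := cast_choose_two_bounds r
  have hmul : (r : ℝ) * (r - 1) / 2 * (log σ + σ ^ 2 * B ^ 2 + 3 / 2 * (m * c) * (1 - 1 / σ)) ≤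
      (9 * m ^ 2 + 18 * m ^ 4 + 27 / 2 * m ^ 3 * c) * (r ^ 4 / d) := by
    calc _ ≤ (r : ℝ) * (r - 1) / 2 * ((18 * m ^ 2 + 36 * m ^ 4 + 27 * m ^ 3 * c) * e) :=
          mul_le_mul_of_nonneg_left hL hrr.1
      _ ≤ (r : ℝ) ^ 2 / 2 * ((18 * m ^ 2 + 36 * m ^ 4 + 27 * m ^ 3 * c) * e) :=
          mul_le_mul_of_nonneg_right hrr.2 (by positivity)
      _ = _ := by rw [he]; ring
  linarith

end GaussianRamsey

/-! ### Absorbing the error terms into the constants -/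

theorem proposition5p2 (C : ℝ) (hC : 1 < C) (p : ℝ) (hp : p ∈ Set.Ioo (0 : ℝ) (1 / 2)) :
    0 < GaussianRamsey.gammaConst p ∧ 0 < GaussianRamsey.betaQuad p ∧
    ∃ K > (0 : ℝ), ∃ M > (0 : ℝ), ∃ D₀ > (0 : ℝ),
      ∀ D : ℝ, D₀ ≤ D → ∀ ℓ d : ℕ, 1 ≤ ℓ → (d : ℝ) = D ^ 2 * (ℓ : ℝ) ^ 2 →
        ∀ r : ℕ, 1 ≤ r → (r : ℝ) ≤ C * ℓ →
          GaussianRamsey.probRedPerfect C p ℓ r d ≤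
            p ^ (r.choose 2) * Real.exp
              (-(GaussianRamsey.aConst p ^ 3 / (p ^ 3 * √(d : ℝ))) * (r.choose 3 : ℝ)
                + K * ((r : ℝ) ^ 3 / (D * √(d : ℝ)))
                - GaussianRamsey.betaQuad p * ((r : ℝ) ^ 4 / d)
                + M / D * ((r : ℝ) ^ 4 / d)) ∧
          GaussianRamsey.probRed p r d ≤
            p ^ (r.choose 2) * Real.exp
              (-(GaussianRamsey.aConst p ^ 3 / (p ^ 3 * √(d : ℝ))) * (r.choose 3 : ℝ)
                + K * ((r : ℝ) ^ 3 / (D * √(d : ℝ)))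
                - GaussianRamsey.betaQuad p * ((r : ℝ) ^ 4 / d)
                + M / D * ((r : ℝ) ^ 4 / d)) := by
  open GaussianRamsey in
  have hβ := betaQuad_pos hp
  refine ⟨gammaConst_pos hp, hβ, ?_⟩
  obtain ⟨m, hm⟩ : ∃ m, m = aConst p / p := ⟨_, rfl⟩
  obtain ⟨c, hc⟩ : ∃ c, c = threshold p := ⟨_, rfl⟩
  have hm0 : 0 < m := hm ▸ div_pos (aConst_pos p) hp.1
  have hc0 : 0 < c := hc ▸ (threshold_spec hp).1
  have hC0 : 0 < C := by linarith
  obtain ⟨K₁, hK₁⟩ : ∃ x, x = 9 * m ^ 2 + 18 * m ^ 4 + 27 / 2 * m ^ 3 * c := ⟨_, rfl⟩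
  obtain ⟨K₂, hK₂⟩ : ∃ x, x = m * c + m ^ 3 * C := ⟨_, rfl⟩
  have hK₁0 : 0 < K₁ := by rw [hK₁]; positivity
  have hK₂0 : 0 < K₂ := by rw [hK₂]; positivity
  -- The summands of K pay for the r⁴/d error, the fluctuation of the norms and the β_quad term. The
  -- M-term is nonnegative slack, so M = 1 does. The summands of D₀ ensure D ≥ 1, 36m²r² ≤ d and 2τ
  -- ≤ d.
  refine ⟨K₁ * C + K₂ ^ 2 + betaQuad p * C, by positivity, 1, one_pos,
    1 + 6 * m * C + 2 * C * K₂, by positivity, fun D hD ℓ d hℓ hd r hr hrC => ?_⟩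
  have hℓ1 : (1 : ℝ) ≤ ℓ := by exact_mod_cast hℓ
  have hmC : 0 < m * C := by positivity
  have hCK : 0 < C * K₂ := by positivity
  have hD1 : 1 ≤ D := by linarith
  have hD0 : 0 < D := by linarith
  have hR : √(d : ℝ) = D * ℓ := by
    rw [hd, ← mul_pow, Real.sqrt_sq (by positivity)]
  have hd0 : (0 : ℝ) < d := by rw [hd]; positivity
  have hr1 : (1 : ℝ) ≤ r := by exact_mod_cast hr
  have hr0 : (0 : ℝ) < r := by linarith
  have hratio : (r : ℝ) / (D * ℓ) ≤ C := by
    rw [div_le_iff₀ (by positivity)]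
    nlinarith [mul_le_mul_of_nonneg_left hD1 (by positivity : 0 ≤ C * ℓ)]
  have hτr : r * (m * c) + m ^ 3 / √d * r ^ 2 ≤ r * K₂ := by
    have : m ^ 3 / √d * r ^ 2 = r * (m ^ 3 * (r / (D * ℓ))) := by rw [hR]; field_simp
    rw [this, ← mul_add, hK₂]
    gcongr
  have h36 : 36 * m ^ 2 * r ^ 2 ≤ d := by
    have : 6 * m * r ≤ D * ℓ := by
      calc 6 * m * r ≤ 6 * m * (C * ℓ) := by gcongr
        _ = 6 * m * C * ℓ := by ring
        _ ≤ D * ℓ := by gcongr; linarith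
    calc _ = (6 * m * r) ^ 2 := by ring
      _ ≤ (D * ℓ) ^ 2 := by gcongr
      _ = d := by rw [hd]; ring
  have h2τ : 2 * (r * (m * c) + m ^ 3 / √d * r ^ 2) ≤ d := by
    calc _ ≤ 2 * (r * K₂) := by linarith
      _ ≤ 2 * (C * ℓ * K₂) := by gcongr
      _ = 2 * C * K₂ * ℓ := by ring
      _ ≤ D * ℓ := by gcongr; linarith
      _ ≤ (D * ℓ) * (D * ℓ) := le_mul_of_one_le_left (by positivity) (by nlinarith)
      _ = d := by rw [hd]; ring
  have hmain := probRed_le hp hm hc (Nat.cast_pos.1 hd0) h36 h2τ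
  set X : ℝ := (r : ℝ) ^ 3 / (D * √(d : ℝ)) with hX
  -- The decisive comparison: r⁴/d = X · r/ℓ, because √d = Dℓ.
  have hr4 : (r : ℝ) ^ 4 / d ≤ C * X := by
    have h1 : (r : ℝ) ^ 4 / d = X * (r / ℓ) := by rw [hX, hR, hd]; field_simp
    have h2 : (r : ℝ) / ℓ ≤ C := by rwa [div_le_iff₀ (by positivity)]
    rw [h1, mul_comm C]
    gcongr
  have hr3 : r * ((r * (m * c) + m ^ 3 / √d * r ^ 2) ^ 2 / d) ≤ K₂ ^ 2 * X := by
    calc _ ≤ r * ((r * K₂) ^ 2 / d) := by gcongr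
      _ = K₂ ^ 2 * X / ℓ := by rw [hX, hR, hd]; field_simp
      _ ≤ K₂ ^ 2 * X := div_le_self (by positivity) hℓ1
  have hbound : probRed p r d ≤ p ^ (r.choose 2) * Real.exp
      (-(aConst p ^ 3 / (p ^ 3 * √(d : ℝ))) * (r.choose 3 : ℝ)
        + (K₁ * C + K₂ ^ 2 + betaQuad p * C) * X
        - betaQuad p * ((r : ℝ) ^ 4 / d) + 1 / D * ((r : ℝ) ^ 4 / d)) := by
    refine hmain.trans (mul_le_mul_of_nonneg_left (Real.exp_le_exp.2 ?_) (pow_nonneg hp.1.le _))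
    have hlead : m ^ 3 / √d * r.choose 3 = aConst p ^ 3 / (p ^ 3 * √(d : ℝ)) * r.choose 3 := by
      rw [hm, div_pow, div_div]
    have hM : 0 ≤ 1 / D * ((r : ℝ) ^ 4 / d) := by positivity
    rw [hlead, ← hK₁]
    nlinarith [mul_le_mul_of_nonneg_left hr4 hK₁0.le, mul_le_mul_of_nonneg_left hr4 hβ.le]
  exact ⟨(probRedPerfect_le_probRed C p ℓ r d).trans hbound, hbound⟩
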